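/- \textbf{Setting.} Let $(\tilde M,\tilde\omega)$ be a (finite-dimensional, smooth) symplectic manifold and let $G$ be a compact Lie group with Lie algebra $\mathfrak g$, $\dim G=\tfrac12\dim\tilde M$, acting smoothly and freely on $\tilde M$ with momentum map $\mu\colon\tilde M\to\mathfrak g^*$; that is, $\mu$ is smooth, $G$-equivariant for the coadjoint action, and $\iota_{X_\xi}\tilde\omega=-\langle d\mu,\xi\rangle$ for all $\xi\in\mathfrak g$, where $X_\xi$ is the vector field generated by $\xi$. Assume that $\mu$ is a principal $G$-bundle over its image, i.e. that the fibres of $\mu$ are exactly the $G$-orbits. Let $\tilde g$ be a $G$-invariant riemannian metric on $\tilde M$ compatible with $\tilde\omega$, i.e. $\tilde g(v,w)=\tilde\omega(v,Jw)$ for an almost complex structure $J$ (for instance a $G$-invariant K\"ahler metric with K\"ahler form $\tilde\omega$). Let $N$ be a closed normal subgroup of $G$ with Lie algebra $\mathfrak n$, let $i^*\colon\mathfrak g^*\to\mathfrak n^*$ and $u^*\colon(\mathfrak g/\mathfrak n)^*\to\mathfrak g^*$ be the adjoints of the inclusion $\mathfrak n\to\mathfrak g$ and of the projection $\mathfrak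 g\to\mathfrak g/\mathfrak n$, let $\tilde c\in\mathfrak g^*$ be invariant under the coadjoint action, and put $c=i^*(\tilde c)$ and $\mu_N=i^*\circ\mu$. Let $Z=\mu_N^{-1}(c)$, with its structure of embedded submanifold of $\tilde M$ and the metric induced by $\tilde g$, and let $M=Z/N$, with its quotient manifold structure, for which the projection $q\colon Z\to M$ is a smooth submersion. Let $\nu\colon M\to(\mathfrak g/\mathfrak n)^*$ be the map induced by the restriction of $\mu-\tilde c$ to $Z$, and let $\ell=u^*+\tilde c\colon(\mathfrak g/\mathfrak n)^*\to\mathfrak g^*$, so that $\ell\circ\nu\circ q=\mu|_Z$. \textbf{Lemma.} \begin{enumerate} \item The image of $\mu$ is open in $\mathfrak g^*$, and there is a unique smooth riemannian metric $\tilde g_{\rm red}$ on $\operatorname{im}\mu$ such that $\mu$ is a riemannian submersion from $\tilde g$ to $\tilde g_{\rm red}$. \item There is a unique smooth riemannian metric $g$ on $M$ such that $q$ is a riemannian submersion from $Z$ to $(M,g)$. The image of $\nu$ is open in $(\mathfrak g/\mathfrak n)^*$, and there is a unique smooth riemannian metric $g_{\rm red}$ on $\operatorname{im}\nu$ such that $\nu$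 is a riemannian submersion from $g$ to $g_{\rm red}$. \item The map $\ell$ sends $\operatorname{im}\nu$ into $\operatorname{im}\mu$, and the reduced metrics are related by \[ \ell^*\tilde g_{\rm red}=g_{\rm red}. \] \end{enumerate} -/

import Mathlib

open scoped Manifold ContDiff

noncomputable section

/-! The manifolds below are smooth manifolds without boundary, charted on a finite-dimensional
real vector space. The tangent space of such a manifold at a point is, in Mathlib, the model vector
space; in particular the Lie algebra `𝔤 = T₁G` of a Lie group `G` charted on `EG` is `EG`, and `𝔤*`
is `StrongDual ℝ EG`. -/

section Tensors

variable {E : Type*} [NormedAddCommGroup E] [NormedSpace ℝ E]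
  {X : Type*} [TopologicalSpace X] [ChartedSpace E X]
  {F : Type*} [NormedAddCommGroup F] [NormedSpace ℝ F]
  {Y : Type*} [TopologicalSpace Y] [ChartedSpace F Y]

/-- A symplectic form: a smooth, alternating, nondegenerate, closed field of bilinear forms.
Closedness is expressed in the charts: in the local coordinates given by each preferred chart, the
exterior derivative `∂_u Ω(v, w) + ∂_v Ω(w, u) + ∂_w Ω(u, v)` vanishes for all constant
`u, v, w`. -/
structure IsSymplecticForm [IsManifold 𝓘(ℝ, E) ∞ X]
    (Ω : ∀ x : X, TangentSpace 𝓘(ℝ, E) x →L[ℝ] TangentSpace 𝓘(ℝ, E) x →L[ℝ] ℝ) : Prop where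
  smooth : ContMDiff 𝓘(ℝ, E) (𝓘(ℝ, E).prod 𝓘(ℝ, E →L[ℝ] E →L[ℝ] ℝ)) ∞
    (fun x : X ↦ (Bundle.TotalSpace.mk' (E →L[ℝ] E →L[ℝ] ℝ) x (Ω x) :
      Bundle.TotalSpace (E →L[ℝ] E →L[ℝ] ℝ)
        (fun x : X ↦ TangentSpace 𝓘(ℝ, E) x →L[ℝ] TangentSpace 𝓘(ℝ, E) x →L[ℝ] ℝ)))
  alternating : ∀ (x : X) (v : TangentSpace 𝓘(ℝ, E) x), Ω x v v = 0
  nondegenerate : ∀ (x : X) (v : TangentSpace 𝓘(ℝ, E) x), (∀ w, Ω x v w = 0) → v = 0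
  closed : ∀ (x₀ : X), ∀ y ∈ (extChartAt 𝓘(ℝ, E) x₀).target, ∀ u v w : E,
    let c : E → E → E → ℝ := fun y a b ↦
      Ω ((extChartAt 𝓘(ℝ, E) x₀).symm y)
        (mfderiv 𝓘(ℝ, E) 𝓘(ℝ, E) (extChartAt 𝓘(ℝ, E) x₀).symm y a)
        (mfderiv 𝓘(ℝ, E) 𝓘(ℝ, E) (extChartAt 𝓘(ℝ, E) x₀).symm y b)
    fderiv ℝ (fun y ↦ c y v w) y u + fderiv ℝ (fun y ↦ c y w u) y v
      + fderiv ℝ (fun y ↦ c y u v) y w = 0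

/-- A smooth Riemannian metric on the manifold `X`. -/
abbrev SmoothMetric (E : Type*) [NormedAddCommGroup E] [NormedSpace ℝ E]
    (X : Type*) [TopologicalSpace X] [ChartedSpace E X] [IsManifold 𝓘(ℝ, E) ∞ X] : Type _ :=
  Bundle.ContMDiffRiemannianMetric 𝓘(ℝ, E) ∞ E (fun x : X ↦ TangentSpace 𝓘(ℝ, E) x)

/-- The metric `g` is compatible with `Ω`: `g(v, w) = Ω(v, J w)` for an almost complex
structure `J`. -/
def IsCompatibleMetric [IsManifold 𝓘(ℝ, E) ∞ X]
    (Ω : ∀ x : X, TangentSpace 𝓘(ℝ, E) x →L[ℝ] TangentSpace 𝓘(ℝ, E) x →L[ℝ] ℝ)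
    (g : SmoothMetric E X) : Prop :=
  ∃ J : ∀ x : X, TangentSpace 𝓘(ℝ, E) x →L[ℝ] TangentSpace 𝓘(ℝ, E) x,
    (∀ x v, J x (J x v) = -v) ∧ ∀ x v w, g.inner x v w = Ω x v (J x w)

/-- `f : X → Y` is a riemannian submersion onto its image for the fields of bilinear forms `gX`
and `gY`: it is a smooth submersion whose differentials are isometric on the orthogonal complements
of their kernels. Only the values of `gY` on the image of `f` matter. -/
structure IsRiemannianSubmersion
    (gX : ∀ x : X, TangentSpace 𝓘(ℝ, E) x → TangentSpace 𝓘(ℝ, E) x → ℝ)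
    (gY : ∀ y : Y, TangentSpace 𝓘(ℝ, F) y → TangentSpace 𝓘(ℝ, F) y → ℝ)
    (f : X → Y) : Prop where
  smooth : ContMDiff 𝓘(ℝ, E) 𝓘(ℝ, F) ∞ f
  surjective : ∀ x, Function.Surjective (mfderiv 𝓘(ℝ, E) 𝓘(ℝ, F) f x)
  isometric : ∀ (x : X) (v w : TangentSpace 𝓘(ℝ, E) x),
    (∀ k, mfderiv 𝓘(ℝ, E) 𝓘(ℝ, F) f x k = 0 → gX x v k = 0) →
    (∀ k, mfderiv 𝓘(ℝ, E) 𝓘(ℝ, F) f x k = 0 → gX x w k = 0) →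
    gY (f x) (mfderiv 𝓘(ℝ, E) 𝓘(ℝ, F) f x v) (mfderiv 𝓘(ℝ, E) 𝓘(ℝ, F) f x w) = gX x v w

/-- `b` is a reduced metric of `gX` along the map `f : X → F` to a vector space: the image of `f` is
open, `b` is a smooth riemannian metric on it, and `f` is a riemannian submersion from `gX`
to `b`. -/
structure IsReducedMetric
    (gX : ∀ x : X, TangentSpace 𝓘(ℝ, E) x → TangentSpace 𝓘(ℝ, E) x → ℝ)
    (f : X → F) (b : F → F →L[ℝ] F →L[ℝ] ℝ) : Prop where
  isOpen_image : IsOpen (Set.range f)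
  smooth : ContDiffOn ℝ ∞ b (Set.range f)
  symm : ∀ α ∈ Set.range f, ∀ v w, b α v w = b α w v
  pos : ∀ α ∈ Set.range f, ∀ v, v ≠ 0 → 0 < b α v v
  submersion : IsRiemannianSubmersion (F := F) gX (fun α v w ↦ b α v w) f

/-- The restriction (first fundamental form) of a metric to a subset `Z` which carries a manifold
structure of its own. -/
def SmoothMetric.restrict [IsManifold 𝓘(ℝ, E) ∞ X] (g : SmoothMetric E X) (Z : Set X)
    (EZ : Type*) [NormedAddCommGroup EZ] [NormedSpace ℝ EZ] [ChartedSpace EZ Z] (z : Z)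
    (v w : TangentSpace 𝓘(ℝ, EZ) z) : ℝ :=
  g.inner (z : X) (mfderiv 𝓘(ℝ, EZ) 𝓘(ℝ, E) (Subtype.val : Z → X) z v)
    (mfderiv 𝓘(ℝ, EZ) 𝓘(ℝ, E) (Subtype.val : Z → X) z w)

end Tensors

section Actions

set_option linter.unusedSectionVars false

variable {EG : Type*} [NormedAddCommGroup EG] [NormedSpace ℝ EG]
  {G : Type*} [Group G] [TopologicalSpace G] [ChartedSpace EG G]
  {E : Type*} [NormedAddCommGroup E] [NormedSpace ℝ E]
  {X : Type*} [TopologicalSpace X] [ChartedSpace E X] [MulAction G X]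

variable (EG) in
/-- The adjoint action of `G` on its Lie algebra. -/
def adjointAction (g : G) : EG →L[ℝ] EG :=
  mfderiv 𝓘(ℝ, EG) 𝓘(ℝ, EG) (fun h : G ↦ g * h * g⁻¹) 1

variable (E G) in
/-- The vector field on `X` generated by the Lie algebra element `ξ`. -/
def fundamentalField (ξ : EG) (z : X) : TangentSpace 𝓘(ℝ, E) z :=
  (mfderiv 𝓘(ℝ, EG) 𝓘(ℝ, E) (fun g : G ↦ g • z) 1 : EG → E) ξ

variable (G) in
/-- `μ` is a momentum map: a smooth `G`-equivariant map `X → 𝔤*` with `ι_{X_ξ} Ω = -⟨dμ, ξ⟩`. -/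
structure IsMomentumMap
    (Ω : ∀ x : X, TangentSpace 𝓘(ℝ, E) x →L[ℝ] TangentSpace 𝓘(ℝ, E) x →L[ℝ] ℝ)
    (μ : X → StrongDual ℝ EG) : Prop where
  smooth : ContMDiff 𝓘(ℝ, E) 𝓘(ℝ, StrongDual ℝ EG) ∞ μ
  equivariant : ∀ (g : G) (z : X), μ (g • z) = (μ z).comp (adjointAction EG g⁻¹)
  hamiltonian : ∀ (ξ : EG) (z : X) (v : TangentSpace 𝓘(ℝ, E) z),
    Ω z (fundamentalField G E ξ z) v =
      -(NormedSpace.fromTangentSpace (μ z) (mfderiv 𝓘(ℝ, E) 𝓘(ℝ, StrongDual ℝ EG) μ z v)) ξ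

variable (G) in
/-- `G` acts by isometries of `g`. -/
def IsInvariantMetric [IsManifold 𝓘(ℝ, E) ∞ X] (g : SmoothMetric E X) : Prop :=
  ∀ (a : G) (z : X) (v w : TangentSpace 𝓘(ℝ, E) z),
    g.inner (a • z) (mfderiv 𝓘(ℝ, E) 𝓘(ℝ, E) (fun z : X ↦ a • z) z v)
      (mfderiv 𝓘(ℝ, E) 𝓘(ℝ, E) (fun z : X ↦ a • z) z w) = g.inner z v w

variable (G) in
/-- The fibres of `μ` are exactly the `G`-orbits. (For a free action and a submersion `μ`, this says
that `μ` is a principal `G`-bundle over its image.) -/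
def FibresAreOrbits {V : Type*} (μ : X → V) : Prop :=
  ∀ z w : X, μ z = μ w ↔ ∃ g : G, g • z = w

variable (EG) in
/-- The Lie algebra `𝔫` of a subgroup `N`, formed by the velocities of the one-parameter subgroups
of `G` which stay in `N`. (When `N` is closed these already form a linear subspace.) -/
def lieAlgebraOf (N : Subgroup G) : Submodule ℝ EG :=
  Submodule.span ℝ {ξ : EG | ∃ γ : ℝ → G, ContMDiff 𝓘(ℝ, ℝ) 𝓘(ℝ, EG) ∞ γ ∧
    (∀ s t, γ (s + t) = γ s * γ t) ∧ (∀ t, γ t ∈ N) ∧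
    (mfderiv 𝓘(ℝ, ℝ) 𝓘(ℝ, EG) γ 0 : ℝ → EG) 1 = ξ}

instance isClosed_lieAlgebraOf [FiniteDimensional ℝ EG] (N : Subgroup G) :
    IsClosed (lieAlgebraOf EG N : Set EG) :=
  (lieAlgebraOf EG N).closed_of_finiteDimensional

variable (EG) in
/-- `i* : 𝔤* → 𝔫*`, adjoint to the inclusion `i : 𝔫 → 𝔤`. -/
def iStar (N : Subgroup G) (α : StrongDual ℝ EG) : StrongDual ℝ (lieAlgebraOf EG N) :=
  α.comp (lieAlgebraOf EG N).subtypeL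

variable (EG) in
/-- `(𝔤/𝔫)*`. -/
abbrev QuotDual (N : Subgroup G) : Type _ := StrongDual ℝ (EG ⧸ lieAlgebraOf EG N)

variable (EG) in
/-- `u* : (𝔤/𝔫)* → 𝔤*`, adjoint to the projection `u : 𝔤 → 𝔤/𝔫`. -/
def uStar (N : Subgroup G) (β : QuotDual EG N) : StrongDual ℝ EG :=
  β.comp (lieAlgebraOf EG N).mkQL

/-- The affine map `ℓ = u* + c̃ : (𝔤/𝔫)* → 𝔤*`. -/
def affineEmb (N : Subgroup G) (c : StrongDual ℝ EG) (β : QuotDual EG N) : StrongDual ℝ EG :=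
  uStar EG N β + c

/-- The level set `μ_N⁻¹(i* c̃)` of the momentum map `μ_N = i* ∘ μ` of `N`. -/
def momentumLevel (N : Subgroup G) (μ : X → StrongDual ℝ EG) (c : StrongDual ℝ EG) : Set X :=
  (iStar EG N ∘ μ) ⁻¹' {iStar EG N c}

/-- Lying on the same `N`-orbit, for points of a subset `Z`. -/
def orbitSetoidOn (N : Subgroup G) (Z : Set X) : Setoid Z where
  r z w := ∃ n ∈ N, n • (z : X) = w
  iseqv := by
    refine ⟨fun z ↦ ⟨1, N.one_mem, one_smul _ _⟩, ?_, ?_⟩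
    · rintro z w ⟨n, hn, h⟩
      exact ⟨n⁻¹, N.inv_mem hn, by rw [← h, inv_smul_smul]⟩
    · rintro z w y ⟨n, hn, h⟩ ⟨m, hm, h'⟩
      exact ⟨m * n, N.mul_mem hm hn, by rw [mul_smul, h, h']⟩

/-- The quotient `M = μ_N⁻¹(i* c̃)/N`, with the quotient topology. -/
abbrev ReducedSpace (N : Subgroup G) (μ : X → StrongDual ℝ EG) (c : StrongDual ℝ EG) : Type _ :=
  Quotient (orbitSetoidOn N (momentumLevel N μ c))

/-- The projection `q : μ_N⁻¹(i* c̃) → M`. -/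
def reducedProj (N : Subgroup G) (μ : X → StrongDual ℝ EG) (c : StrongDual ℝ EG)
    (z : momentumLevel N μ c) : ReducedSpace N μ c :=
  Quotient.mk _ z

theorem le_ker_of_mem_momentumLevel (N : Subgroup G) (μ : X → StrongDual ℝ EG)
    (c : StrongDual ℝ EG) (z : momentumLevel N μ c) :
    lieAlgebraOf EG N ≤ (μ z - c).ker := by
  intro ξ hξ
  have h : iStar EG N (μ z) = iStar EG N c := z.2
  have h' := DFunLike.congr_fun h ⟨ξ, hξ⟩
  have h'' : μ z ξ = c ξ := h'
  simp [h'']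

/-- The momentum map `ν : M → (𝔤/𝔫)*`, induced by the restriction of `μ - c̃`, which vanishes
on `𝔫`. -/
def reducedMomentum (N : Subgroup G) (μ : X → StrongDual ℝ EG) (c : StrongDual ℝ EG)
    (hμ : FibresAreOrbits G μ) : ReducedSpace N μ c → QuotDual EG N :=
  Quotient.lift
    (fun z : momentumLevel N μ c ↦
      (lieAlgebraOf EG N).liftQL (μ z - c) (le_ker_of_mem_momentumLevel N μ c z))
    (by
      rintro z w ⟨n, -, h⟩
      have h' : μ z = μ w := (hμ _ _).2 ⟨n, h⟩
      simp only [h'])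

/-- The defining property of `ν` and `ℓ`: `ℓ ∘ ν ∘ q = μ` on `μ_N⁻¹(i* c̃)`. -/
theorem affineEmb_reducedMomentum (N : Subgroup G) (μ : X → StrongDual ℝ EG)
    (c : StrongDual ℝ EG) (hμ : FibresAreOrbits G μ) (z : momentumLevel N μ c) :
    affineEmb N c (reducedMomentum N μ c hμ (reducedProj N μ c z)) = μ z := by
  ext ξ
  simp [affineEmb, uStar, reducedMomentum, reducedProj]

end Actions

end

/-!
For a surjective linear map `A` from an inner product space `(V, B)`, let `pushForm B A` be the
inner product on the target for which `A` is isometric on the orthogonal complement of its kernel.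
A submersion is riemannian if and only if the metric of its target at `f x` is the push-forward of
the metric at `x` along the differential of `f` at `x` (`isRiemannianSubmersion_iff`,
`isReducedMetric_iff`). Uniqueness of the metrics in the theorem is immediate from this, and their
existence amounts to the following three facts.

* The maps `μ`, `q` and `ν` are submersions. For `μ` this is the freeness of the action: an element
  of `𝔤` annihilating the image of the differential of `μ` at `z` has a fundamental field vanishing
  at `z`, so its one-parameter group locally fixes `z`
  (`IsMomentumMap.differential_surjective`). For `q` it is an assumption, and for `ν` it
  follows from that for `μ`, because the tangent spaces of the momentum level are as large as they
  can be (see the last paragraph).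
* Push-forwards are constant along the fibres. The fibres of `μ` and `q` are orbits of groups
  acting by isometries which preserve `μ` and `q` (`pushForm_eq_of_symmetry`); for `ν` this follows
  from the comparison with `μ` below.
* The resulting field of inner products is smooth (`IsSmoothFormAt.pushForward`). Indeed
  `pushForm B A = (A B⁻¹ Aᵀ)⁻¹` depends smoothly on `B` and `A`, and a submersion has smooth local
  sections (`exists_local_section`).

The relation between the reduced metrics is the naturality of push-forwards
(`IsInnerForm.pushForm_natural`), applied to the square formed by the inclusion of the tangent space
of the momentum level, by the differentials of `ν ∘ q` and of `μ`, and by `u*`. What has to be known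
is that the tangent space of the level contains the kernel of the differential of `μ`, and more
generally the preimage of the image of `u*`: since `G` has half the dimension of the manifold, such
a vector is tangent to a local section of `μ` over the image of `ℓ`, up to a vector tangent to a
`G`-orbit (`exists_differential_val_eq_of_differential_eq_uStarL`), and both lie in the level.
-/

noncomputable section

/-! ### Pulling back and pushing forward inner products -/

section LinearAlgebra

variable {E : Type*} [NormedAddCommGroup E] [NormedSpace ℝ E]
  {F : Type*} [NormedAddCommGroup F] [NormedSpace ℝ F]
  {E' : Type*} [NormedAddCommGroup E'] [NormedSpace ℝ E']
  {F' : Type*} [NormedAddCommGroup F'] [NormedSpace ℝ F']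

/-- An inner product: a symmetric, positive definite bilinear form. -/
structure IsInnerForm (B : E →L[ℝ] E →L[ℝ] ℝ) : Prop where
  symm : ∀ v w, B v w = B w v
  pos : ∀ v, v ≠ 0 → 0 < B v v

/-- `v` is horizontal for the linear map `A`: it is `B`-orthogonal to the kernel of `A`. -/
def IsHorizontal (B : E →L[ℝ] E →L[ℝ] ℝ) (A : E →L[ℝ] F) (v : E) : Prop :=
  ∀ k, A k = 0 → B v k = 0

/-- The pullback `B(A·, A·)` of a bilinear form. -/
def pullForm (B : F →L[ℝ] F →L[ℝ] ℝ) (A : E →L[ℝ] F) : E →L[ℝ] E →L[ℝ] ℝ :=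
  (A.precomp ℝ) ∘L B ∘L A

/-- The push-forward `(A B⁻¹ Aᵀ)⁻¹` of an inner product `B` along a surjective linear map `A`, that
is, the inner product making `A` isometric on the orthogonal complement of its kernel. The formula
exhibits it as a smooth function of `B` and `A`. -/
def pushForm (B : E →L[ℝ] E →L[ℝ] ℝ) (A : E →L[ℝ] F) : F →L[ℝ] F →L[ℝ] ℝ :=
  (A ∘L B.inverse ∘L (A.precomp ℝ)).inverse

@[simp]
theorem pullForm_apply (B : F →L[ℝ] F →L[ℝ] ℝ) (A : E →L[ℝ] F) (v w : E) :
    pullForm B A v w = B (A v) (A w) := rfl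

theorem IsInnerForm.pull {B : F →L[ℝ] F →L[ℝ] ℝ} (hB : IsInnerForm B) {A : E →L[ℝ] F}
    (hA : ∀ v, A v = 0 → v = 0) : IsInnerForm (pullForm B A) where
  symm _ _ := hB.symm _ _
  pos v hv := hB.pos _ fun h ↦ hv (hA v h)

theorem contDiff_precomp :
    ContDiff ℝ ∞ (fun A : E →L[ℝ] F ↦ (A.precomp ℝ : (F →L[ℝ] ℝ) →L[ℝ] (E →L[ℝ] ℝ))) :=
  ContinuousLinearMap.contDiff (𝕜 := ℝ) (E := E →L[ℝ] F) (F := (F →L[ℝ] ℝ) →L[ℝ] (E →L[ℝ] ℝ))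
    (ContinuousLinearMap.compL ℝ E F ℝ).flip

theorem contDiff_pullForm :
    ContDiff ℝ ∞ (fun p : (F →L[ℝ] F →L[ℝ] ℝ) × (E →L[ℝ] F) ↦ pullForm p.1 p.2) :=
  (contDiff_precomp.comp contDiff_snd).clm_comp (contDiff_fst.clm_comp contDiff_snd)

variable [FiniteDimensional ℝ E]

theorem isInvertible_of_ker_eq_zero {B : E →L[ℝ] E →L[ℝ] ℝ} (hB : ∀ v, B v v = 0 → v = 0) :
    B.IsInvertible := by
  have hinj : Function.Injective (B : E →ₗ[ℝ] E →L[ℝ] ℝ) := by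
    rw [injective_iff_map_eq_zero]
    intro v hv
    apply hB
    have : B v = 0 := hv
    simp [this]
  have hfin : Module.finrank ℝ E = Module.finrank ℝ (E →L[ℝ] ℝ) := by
    rw [← (LinearMap.toContinuousLinearMap (𝕜 := ℝ) (E := E) (F' := ℝ)).finrank_eq]
    exact (Subspace.dual_finrank_eq).symm
  exact ⟨(LinearEquiv.ofInjectiveOfFinrankEq (B : E →ₗ[ℝ] E →L[ℝ] ℝ) hinj
    hfin).toContinuousLinearEquiv, by ext; rfl⟩

theorem IsInnerForm.isInvertible {B : E →L[ℝ] E →L[ℝ] ℝ} (hB : IsInnerForm B) :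
    B.IsInvertible :=
  isInvertible_of_ker_eq_zero fun v hv ↦ by
    by_contra h
    exact (hB.pos v h).ne' hv

theorem IsInnerForm.apply_inverse {B : E →L[ℝ] E →L[ℝ] ℝ} (hB : IsInnerForm B) (l : E →L[ℝ] ℝ) :
    B (B.inverse l) = l := by
  obtain ⟨e, rfl⟩ := hB.isInvertible
  simp

variable [FiniteDimensional ℝ F]

theorem IsInnerForm.gram_isInvertible {B : E →L[ℝ] E →L[ℝ] ℝ} (hB : IsInnerForm B)
    {A : E →L[ℝ] F} (hA : Function.Surjective A) :
    (A ∘L B.inverse ∘L (A.precomp ℝ)).IsInvertible := by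
  have hinj : Function.Injective
      (A ∘L B.inverse ∘L (A.precomp ℝ) : (F →L[ℝ] ℝ) →ₗ[ℝ] F) := by
    rw [injective_iff_map_eq_zero]
    intro l hl
    have hl' : A (B.inverse (l ∘L A)) = 0 := hl
    have h0 : B.inverse (l ∘L A) = 0 := by
      by_contra h
      have h1 := hB.pos _ h
      rw [hB.apply_inverse, ContinuousLinearMap.comp_apply, hl', map_zero] at h1
      exact h1.false
    have h2 : l ∘L A = 0 := by rw [← hB.apply_inverse (l ∘L A), h0, map_zero]
    ext y
    obtain ⟨v, rfl⟩ := hA y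
    exact DFunLike.congr_fun h2 v
  have hfin : Module.finrank ℝ (F →L[ℝ] ℝ) = Module.finrank ℝ F := by
    rw [← (LinearMap.toContinuousLinearMap (𝕜 := ℝ) (E := F) (F' := ℝ)).finrank_eq]
    exact Subspace.dual_finrank_eq
  exact ⟨(LinearEquiv.ofInjectiveOfFinrankEq _ hinj hfin).toContinuousLinearEquiv, by ext; rfl⟩

/-- The vector `B⁻¹ Aᵀ (pushForm B A y)`, which is the horizontal lift of `y`, is a lift of `y`. -/
theorem IsInnerForm.gram_pushForm {B : E →L[ℝ] E →L[ℝ] ℝ} (hB : IsInnerForm B)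
    {A : E →L[ℝ] F} (hA : Function.Surjective A) (y : F) :
    A (B.inverse (pushForm B A y ∘L A)) = y := by
  obtain ⟨e, he⟩ := hB.gram_isInvertible hA
  have h : pushForm B A y = e.symm y := by
    rw [pushForm, ← he, ContinuousLinearMap.inverse_equiv]
    rfl
  rw [h]
  calc A (B.inverse (e.symm y ∘L A)) = (A ∘L B.inverse ∘L (A.precomp ℝ)) (e.symm y) := rfl
    _ = y := by rw [← he]; simp

theorem IsInnerForm.exists_horizontal_lift {B : E →L[ℝ] E →L[ℝ] ℝ} (hB : IsInnerForm B)
    {A : E →L[ℝ] F} (hA : Function.Surjective A) (y : F) :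
    ∃ v, IsHorizontal B A v ∧ A v = y := by
  refine ⟨B.inverse (pushForm B A y ∘L A), fun k hk ↦ ?_, hB.gram_pushForm hA y⟩
  rw [hB.apply_inverse, ContinuousLinearMap.comp_apply, hk, map_zero]

/-- It suffices that one of the two vectors is horizontal. -/
theorem IsInnerForm.pushForm_apply {B : E →L[ℝ] E →L[ℝ] ℝ} (hB : IsInnerForm B)
    {A : E →L[ℝ] F} (hA : Function.Surjective A) {v : E} (hv : IsHorizontal B A v) (w : E) :
    pushForm B A (A v) (A w) = B v w := by
  -- the lift produced by the formula for `pushForm` is horizontal, hence equal to `v`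
  have h : B.inverse (pushForm B A (A v) ∘L A) = v := by
    set u := B.inverse (pushForm B A (A v) ∘L A) with hu
    have hAu : A (u - v) = 0 := by rw [map_sub, hB.gram_pushForm hA, sub_self]
    have huh : B u (u - v) = 0 := by
      rw [hu, hB.apply_inverse, ContinuousLinearMap.comp_apply, ← hu, hAu, map_zero]
    by_contra hne
    have := hB.pos (u - v) (sub_ne_zero.2 hne)
    have h0 : B (u - v) (u - v) = B u (u - v) - B v (u - v) := by rw [map_sub B]; rfl
    rw [h0, huh, hv _ hAu, sub_zero] at this
    exact this.false
  conv_rhs => rw [← h, hB.apply_inverse]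
  rfl

theorem IsInnerForm.eq_pushForm {B : E →L[ℝ] E →L[ℝ] ℝ} (hB : IsInnerForm B)
    {A : E →L[ℝ] F} (hA : Function.Surjective A) {b : F →L[ℝ] F →L[ℝ] ℝ}
    (hb : ∀ v w, IsHorizontal B A v → IsHorizontal B A w → b (A v) (A w) = B v w) :
    b = pushForm B A := by
  ext y z
  obtain ⟨v, hv, rfl⟩ := hB.exists_horizontal_lift hA y
  obtain ⟨w, hw, rfl⟩ := hB.exists_horizontal_lift hA z
  rw [hb v w hv hw, hB.pushForm_apply hA hv]

theorem IsInnerForm.push {B : E →L[ℝ] E →L[ℝ] ℝ} (hB : IsInnerForm B)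
    {A : E →L[ℝ] F} (hA : Function.Surjective A) : IsInnerForm (pushForm B A) where
  symm y z := by
    obtain ⟨v, hv, rfl⟩ := hB.exists_horizontal_lift hA y
    obtain ⟨w, hw, rfl⟩ := hB.exists_horizontal_lift hA z
    rw [hB.pushForm_apply hA hv, hB.pushForm_apply hA hw, hB.symm]
  pos y hy := by
    obtain ⟨v, hv, rfl⟩ := hB.exists_horizontal_lift hA y
    rw [hB.pushForm_apply hA hv]
    refine hB.pos v ?_
    rintro rfl
    exact hy (map_zero A)

variable [FiniteDimensional ℝ E'] [FiniteDimensional ℝ F']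

/-- Naturality of the push-forward for commutative squares `A' L = M A` whose upper edge `L` is
isometric and whose image contains the kernel of `A'`. -/
theorem IsInnerForm.pushForm_natural {B : E →L[ℝ] E →L[ℝ] ℝ} (hB : IsInnerForm B)
    {A : E →L[ℝ] F} (hA : Function.Surjective A)
    {B' : E' →L[ℝ] E' →L[ℝ] ℝ} (hB' : IsInnerForm B') {A' : E' →L[ℝ] F'}
    (hA' : Function.Surjective A') (L : E →L[ℝ] E') (M : F →L[ℝ] F')
    (hL : ∀ k, A' k = 0 → ∃ v, L v = k) (hM : ∀ y, M y = 0 → y = 0)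
    (hBL : ∀ v w, B' (L v) (L w) = B v w) (hAL : ∀ v, A' (L v) = M (A v)) :
    pullForm (pushForm B' A') M = pushForm B A := by
  refine hB.eq_pushForm hA fun v w hv hw ↦ ?_
  have hLv : IsHorizontal B' A' (L v) := by
    intro k hk
    obtain ⟨k, rfl⟩ := hL k hk
    rw [hBL]
    exact hv k (hM _ (by rw [← hAL, hk]))
  rw [pullForm_apply, ← hAL, ← hAL, hB'.pushForm_apply hA' hLv, hBL]

theorem IsInnerForm.pushForm_comp {B : E →L[ℝ] E →L[ℝ] ℝ} (hB : IsInnerForm B)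
    {A : E →L[ℝ] F} (hA : Function.Surjective A) {A' : F →L[ℝ] F'}
    (hA' : Function.Surjective A') :
    pushForm (pushForm B A) A' = pushForm B (A' ∘L A) := by
  refine hB.eq_pushForm (hA'.comp hA) fun v w hv hw ↦ ?_
  have hvA : IsHorizontal B A v := fun k hk ↦ hv k (by simp [hk])
  have hAv : IsHorizontal (pushForm B A) A' (A v) := by
    intro k hk
    obtain ⟨k, rfl⟩ := hA k
    rw [hB.pushForm_apply hA hvA]
    exact hv k hk
  rw [ContinuousLinearMap.comp_apply, ContinuousLinearMap.comp_apply,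
    (hB.push hA).pushForm_apply hA' hAv, hB.pushForm_apply hA hvA]

theorem IsInnerForm.contDiffAt_pushForm {B : E →L[ℝ] E →L[ℝ] ℝ} (hB : IsInnerForm B)
    {A : E →L[ℝ] F} (hA : Function.Surjective A) :
    ContDiffAt ℝ ∞ (fun p : (E →L[ℝ] E →L[ℝ] ℝ) × (E →L[ℝ] F) ↦ pushForm p.1 p.2) (B, A) := by
  have h1 : ContDiffAt ℝ ∞
      (ContinuousLinearMap.inverse : (E →L[ℝ] E →L[ℝ] ℝ) → ((E →L[ℝ] ℝ) →L[ℝ] E)) B := by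
    obtain ⟨e, rfl⟩ := hB.isInvertible
    have := FiniteDimensional.complete ℝ E
    exact contDiffAt_map_inverse e
  have h2 : ContDiffAt ℝ ∞ (fun p : (E →L[ℝ] E →L[ℝ] ℝ) × (E →L[ℝ] F) ↦
      (p.2 ∘L p.1.inverse ∘L (p.2.precomp ℝ) : (F →L[ℝ] ℝ) →L[ℝ] F)) (B, A) :=
    contDiffAt_snd.clm_comp (ContDiffAt.clm_comp
      (h1.comp (B, A) contDiffAt_fst : ContDiffAt ℝ ∞
        (fun p : (E →L[ℝ] E →L[ℝ] ℝ) × (E →L[ℝ] F) ↦ p.1.inverse) (B, A))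
      (contDiff_precomp.contDiffAt.comp (B, A) contDiffAt_snd))
  have h3 : ContDiffAt ℝ ∞
      (ContinuousLinearMap.inverse : ((F →L[ℝ] ℝ) →L[ℝ] F) → (F →L[ℝ] F →L[ℝ] ℝ))
      (A ∘L B.inverse ∘L (A.precomp ℝ)) := by
    obtain ⟨e, he⟩ := hB.gram_isInvertible hA
    rw [← he]
    exact contDiffAt_map_inverse e
  exact ContDiffAt.comp (B, A) h3 h2

/-- In finite dimension the unit ball of an inner product is bounded. -/
theorem IsInnerForm.isVonNBounded {B : E →L[ℝ] E →L[ℝ] ℝ} (hB : IsInnerForm B) :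
    Bornology.IsVonNBounded ℝ {v : E | B v v < 1} := by
  rw [NormedSpace.isVonNBounded_iff]
  have hcont : Continuous fun v : E ↦ B v v := by fun_prop
  rcases subsingleton_or_nontrivial E with hE | hE
  · exact Set.subsingleton_of_subsingleton.finite.isBounded
  obtain ⟨v₀, hv₀, hmin⟩ := (isCompact_sphere (0 : E) 1).exists_isMinOn
    (NormedSpace.sphere_nonempty.2 zero_le_one) hcont.continuousOn
  have hv₀n : ‖v₀‖ = 1 := by simpa using hv₀
  set m := B v₀ v₀
  have hm : 0 < m := hB.pos v₀ fun h ↦ by simp [h] at hv₀n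
  have hbound : ∀ v, m * ‖v‖ ^ 2 ≤ B v v := by
    intro v
    rcases eq_or_ne v 0 with rfl | hv
    · simp
    have hn : 0 < ‖v‖ := norm_pos_iff.2 hv
    have h := hmin (a := ‖v‖⁻¹ • v) (by simp [norm_smul, hn.ne'])
    simp only [Set.mem_ofPred_eq, map_smul, smul_apply, smul_eq_mul] at h
    calc m * ‖v‖ ^ 2 ≤ (‖v‖⁻¹ * (‖v‖⁻¹ * B v v)) * ‖v‖ ^ 2 := by gcongr
      _ = B v v := by field_simp
  rw [Metric.isBounded_iff_subset_closedBall 0]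
  refine ⟨√(1 / m), fun v hv ↦ ?_⟩
  rw [mem_closedBall_zero_iff]
  refine Real.le_sqrt_of_sq_le ?_
  rw [le_div_iff₀ hm, mul_comm]
  exact (hbound v).trans (le_of_lt hv)

end LinearAlgebra

/-! ### Submersions and immersions -/

section Submersions

open Filter Topology

variable {E : Type*} [NormedAddCommGroup E] [NormedSpace ℝ E]
  {X : Type*} [TopologicalSpace X] [ChartedSpace E X]
  {F : Type*} [NormedAddCommGroup F] [NormedSpace ℝ F]
  {Y : Type*} [TopologicalSpace Y] [ChartedSpace F Y]

/-- A smooth map between finite-dimensional vector spaces has a smooth right inverse near each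
point at which its differential is onto. -/
theorem exists_local_section_of_contDiffAt [FiniteDimensional ℝ E] [FiniteDimensional ℝ F]
    {f : E → F} {x₀ : E} (hf : ContDiffAt ℝ ∞ f x₀)
    (hf' : Function.Surjective (fderiv ℝ f x₀)) :
    ∃ s : F → E, s (f x₀) = x₀ ∧ ContDiffAt ℝ ∞ s (f x₀) ∧ ∀ᶠ y in 𝓝 (f x₀), f (s y) = y := by
  have := FiniteDimensional.complete ℝ F
  obtain ⟨R, hR⟩ := (fderiv ℝ f x₀ : E →ₗ[ℝ] F).exists_rightInverse_of_surjective
    (LinearMap.range_eq_top.2 hf')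
  -- restrict `f` to an affine subspace complementary to the kernel of its differential
  let σ : F → E := fun y ↦ x₀ + R.toContinuousLinearMap y
  have hσ : ContDiff ℝ ∞ σ := contDiff_const.add R.toContinuousLinearMap.contDiff
  have hσ0 : σ 0 = x₀ := by simp [σ]
  have hσ' : HasFDerivAt σ R.toContinuousLinearMap 0 :=
    R.toContinuousLinearMap.hasFDerivAt.const_add x₀
  have hh : ContDiffAt ℝ ∞ (f ∘ σ) 0 := by
    refine ContDiffAt.comp 0 ?_ hσ.contDiffAt
    rwa [hσ0]
  have hh' : HasFDerivAt (f ∘ σ) ((ContinuousLinearEquiv.refl ℝ F : F ≃L[ℝ] F) : F →L[ℝ] F) 0 := by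
    have h1 : HasFDerivAt f (fderiv ℝ f x₀) (σ 0) := by
      rw [hσ0]
      exact (hf.differentiableAt (by simp)).hasFDerivAt
    have h2 := h1.comp 0 hσ'
    convert! h2 using 1
    ext y
    exact (LinearMap.congr_fun hR y).symm
  have hf0 : (f ∘ σ) 0 = f x₀ := by simp [hσ0]
  refine ⟨σ ∘ hh.localInverse hh' (by simp), ?_, ?_, ?_⟩
  · rw [← hf0, Function.comp_apply, hh.localInverse_apply_image hh', hσ0]
  · rw [← hf0]
    exact hσ.contDiffAt.comp _ (hh.to_localInverse hh' (by simp))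
  · rw [← hf0]
    exact (hh.hasStrictFDerivAt' hh' (by simp)).eventually_right_inverse

/-- A submersion has a smooth local section through each point. -/
theorem exists_local_section [IsManifold 𝓘(ℝ, E) ∞ X] [FiniteDimensional ℝ E]
    [FiniteDimensional ℝ F]
    {f : X → Y} {x₀ : X} (hf : ContMDiffAt 𝓘(ℝ, E) 𝓘(ℝ, F) ∞ f x₀)
    (hf' : Function.Surjective (mfderiv 𝓘(ℝ, E) 𝓘(ℝ, F) f x₀)) :
    ∃ s : Y → X, s (f x₀) = x₀ ∧ ContMDiffAt 𝓘(ℝ, F) 𝓘(ℝ, E) ∞ s (f x₀) ∧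
      ∀ᶠ y in 𝓝 (f x₀), f (s y) = y := by
  set φ := extChartAt 𝓘(ℝ, E) x₀
  set ψ := extChartAt 𝓘(ℝ, F) (f x₀)
  have hloc : ContDiffAt ℝ ∞ (ψ ∘ f ∘ φ.symm) (φ x₀) := by
    have := (contMDiffAt_iff.1 hf).2
    rw [← contDiffWithinAt_univ]
    simpa [φ, ψ] using this
  have hder : mfderiv 𝓘(ℝ, E) 𝓘(ℝ, F) f x₀ = fderiv ℝ (ψ ∘ f ∘ φ.symm) (φ x₀) := by
    rw [(hf.mdifferentiableAt (by simp)).mfderiv]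
    simp only [writtenInExtChartAt, modelWithCornersSelf_coe, Set.range_id, fderivWithin_univ]
    rfl
  rw [hder] at hf'
  obtain ⟨s, hs0, hs, hsec⟩ := exists_local_section_of_contDiffAt hloc hf'
  have hpt : (ψ ∘ f ∘ φ.symm) (φ x₀) = ψ (f x₀) := by simp [φ]
  rw [hpt] at hs0 hs hsec
  have hψ : ContinuousAt ψ (f x₀) := continuousAt_extChartAt _
  have hs0' : (φ.symm ∘ s ∘ ψ) (f x₀) = x₀ := by simp [hs0, φ]
  have hsm : ContMDiffAt 𝓘(ℝ, F) 𝓘(ℝ, E) ∞ (φ.symm ∘ s ∘ ψ) (f x₀) := by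
    have h1 : ContMDiffAt 𝓘(ℝ, F) 𝓘(ℝ, F) ∞ ψ (f x₀) := contMDiffAt_extChartAt
    have h2 : ContMDiffAt 𝓘(ℝ, F) 𝓘(ℝ, E) ∞ s (ψ (f x₀)) := hs.contMDiffAt
    have h3 : ContMDiffAt 𝓘(ℝ, E) 𝓘(ℝ, E) ∞ φ.symm (s (ψ (f x₀))) := by
      rw [hs0]
      exact (contMDiffOn_extChartAt_symm x₀).contMDiffAt (extChartAt_target_mem_nhds x₀)
    exact h3.comp (f x₀) (h2.comp (f x₀) h1)
  refine ⟨φ.symm ∘ s ∘ ψ, hs0', hsm, ?_⟩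
  have hsrc : ∀ᶠ y in 𝓝 (f x₀), y ∈ ψ.source := extChartAt_source_mem_nhds (f x₀)
  have hcont : ContinuousAt (f ∘ (φ.symm ∘ s ∘ ψ)) (f x₀) := by
    refine ContinuousAt.comp ?_ hsm.continuousAt
    rw [hs0']
    exact hf.continuousAt
  have hsrc' : ∀ᶠ y in 𝓝 (f x₀), f (φ.symm (s (ψ y))) ∈ ψ.source := by
    refine hcont.eventually_mem ?_
    rw [Function.comp_apply, hs0']
    exact extChartAt_source_mem_nhds (f x₀)
  filter_upwards [hsrc, hsrc', hψ.eventually hsec] with y h1 h2 h3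
  exact ψ.injOn h2 h1 h3

/-- The image of a submersion is open. -/
theorem isOpen_range_of_surjective_mfderiv [IsManifold 𝓘(ℝ, E) ∞ X] [FiniteDimensional ℝ E]
    [FiniteDimensional ℝ F]
    {f : X → Y} (hf : ContMDiff 𝓘(ℝ, E) 𝓘(ℝ, F) ∞ f)
    (hf' : ∀ x, Function.Surjective (mfderiv 𝓘(ℝ, E) 𝓘(ℝ, F) f x)) : IsOpen (Set.range f) := by
  rw [isOpen_iff_mem_nhds]
  rintro _ ⟨x, rfl⟩
  obtain ⟨s, -, -, hs⟩ := exists_local_section (hf x) (hf' x)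
  filter_upwards [hs] with y hy
  exact ⟨s y, hy⟩

/-- A smooth immersion has injective differentials. -/
theorem Manifold.IsImmersionAt.mfderiv_injective {f : X → Y} {x : X}
    (hf : Manifold.IsImmersionAt 𝓘(ℝ, E) 𝓘(ℝ, F) ∞ f x) :
    Function.Injective (mfderiv 𝓘(ℝ, E) 𝓘(ℝ, F) f x) := by
  -- a smooth local retraction, read off the charts in which `f` is `u ↦ (u, 0)`
  let pr : F → E := fun y ↦ (hf.equiv.symm y).1
  let r : Y → X := hf.domChart.symm ∘ pr ∘ hf.codChart
  have hpr : ContMDiff 𝓘(ℝ, F) 𝓘(ℝ, E) ∞ pr :=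
    (contDiff_fst.comp hf.equiv.symm.contDiff).contMDiff
  have hr : ∀ᶠ z in 𝓝 x, r (f z) = z := by
    filter_upwards [hf.domChart.open_source.mem_nhds hf.mem_domChart_source] with z hz
    have h1 := hf.writtenInCharts
      (show hf.domChart z ∈ (hf.domChart.extend 𝓘(ℝ, E)).target by
        simpa using hf.domChart.map_source hz)
    have h2 : hf.codChart (f z) = hf.equiv (hf.domChart z, 0) := by
      simpa [hf.domChart.left_inv hz] using h1
    simp [r, pr, h2, hf.domChart.left_inv hz]
  have hval : pr (hf.codChart (f x)) = hf.domChart x := by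
    have h1 := hf.writtenInCharts
      (show hf.domChart x ∈ (hf.domChart.extend 𝓘(ℝ, E)).target by
        simpa using hf.domChart.map_source hf.mem_domChart_source)
    have h2 : hf.codChart (f x) = hf.equiv (hf.domChart x, 0) := by
      simpa [hf.domChart.left_inv hf.mem_domChart_source] using h1
    simp [pr, h2]
  have hrs : ContMDiffAt 𝓘(ℝ, F) 𝓘(ℝ, E) ∞ r (f x) := by
    have h1 := contMDiffAt_of_mem_maximalAtlas hf.codChart_mem_maximalAtlas hf.mem_codChart_source
    have h2 : ContMDiffAt 𝓘(ℝ, E) 𝓘(ℝ, E) ∞ hf.domChart.symm (pr (hf.codChart (f x))) := by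
      rw [hval]
      exact contMDiffAt_symm_of_mem_maximalAtlas hf.domChart_mem_maximalAtlas
        (hf.domChart.map_source hf.mem_domChart_source)
    exact h2.comp (f x) ((hpr _).comp (f x) h1)
  have hcomp : HasMFDerivAt 𝓘(ℝ, E) 𝓘(ℝ, E) (r ∘ f) x
      ((mfderiv 𝓘(ℝ, F) 𝓘(ℝ, E) r (f x)).comp (mfderiv 𝓘(ℝ, E) 𝓘(ℝ, F) f x)) :=
    (hrs.mdifferentiableAt (by simp)).hasMFDerivAt.comp x
      (hf.contMDiffAt.mdifferentiableAt (by simp)).hasMFDerivAt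
  have hid := (hasMFDerivAt_id (I := 𝓘(ℝ, E)) x).congr_of_eventuallyEq (f₁ := r ∘ f) hr
  have heq := hasMFDerivAt_unique hcomp hid
  intro v w hvw
  have hv := DFunLike.congr_fun heq v
  have hw := DFunLike.congr_fun heq w
  have hv' : (mfderiv 𝓘(ℝ, F) 𝓘(ℝ, E) r (f x)) (mfderiv 𝓘(ℝ, E) 𝓘(ℝ, F) f x v) = v := hv
  have hw' : (mfderiv 𝓘(ℝ, F) 𝓘(ℝ, E) r (f x)) (mfderiv 𝓘(ℝ, E) 𝓘(ℝ, F) f x w) = w := hw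
  rw [← hv', ← hw', hvw]

end Submersions

/-! ### Smooth fields of bilinear forms -/

section Forms

open Filter Topology Bundle

variable {E : Type*} [NormedAddCommGroup E] [NormedSpace ℝ E]
  {X : Type*} [TopologicalSpace X] [ChartedSpace E X]
  {F : Type*} [NormedAddCommGroup F] [NormedSpace ℝ F]
  {Y : Type*} [TopologicalSpace Y] [ChartedSpace F Y]

variable (E F) in
/-- The differential of `f` at `x`, as a map between the model spaces, which are the tangent
spaces. -/
def differential (f : X → Y) (x : X) : E →L[ℝ] F :=
  mfderiv 𝓘(ℝ, E) 𝓘(ℝ, F) f x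

theorem ContMDiffAt.differential_comp {V : Type*} [NormedAddCommGroup V] [NormedSpace ℝ V]
    {W : Type*} [TopologicalSpace W] [ChartedSpace V W] {g : Y → W} {f : X → Y} {x : X}
    (hg : ContMDiffAt 𝓘(ℝ, F) 𝓘(ℝ, V) ∞ g (f x)) (hf : ContMDiffAt 𝓘(ℝ, E) 𝓘(ℝ, F) ∞ f x) :
    differential E V (g ∘ f) x = differential F V g (f x) ∘L differential E F f x :=
  mfderiv_comp x (hg.mdifferentiableAt (by simp)) (hf.mdifferentiableAt (by simp))

theorem differential_id (x : X) : differential E E (id : X → X) x = ContinuousLinearMap.id ℝ E :=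
  mfderiv_id

variable [IsManifold 𝓘(ℝ, E) ∞ X] [IsManifold 𝓘(ℝ, F) ∞ Y]

/-- The field `β` of bilinear forms on the tangent spaces of `X` is smooth at `x₀`. The tangent
spaces of `X` are all equal to its model space `E`, but smoothness refers to the bundle structure,
not to the map `β : X → (E →L[ℝ] E →L[ℝ] ℝ)`. -/
def IsSmoothFormAt (β : X → E →L[ℝ] E →L[ℝ] ℝ) (x₀ : X) : Prop :=
  ContMDiffAt 𝓘(ℝ, E) (𝓘(ℝ, E).prod 𝓘(ℝ, E →L[ℝ] E →L[ℝ] ℝ)) ∞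
    (fun x : X ↦ (TotalSpace.mk' (E →L[ℝ] E →L[ℝ] ℝ) x (β x) :
      TotalSpace (E →L[ℝ] E →L[ℝ] ℝ)
        (fun x : X ↦ TangentSpace 𝓘(ℝ, E) x →L[ℝ] TangentSpace 𝓘(ℝ, E) x →L[ℝ] ℝ))) x₀

variable (E) in
/-- The coordinate frame at `x` given by the preferred chart at `x₀`, as a map `E → TₓX`. -/
def tangentFrame (x₀ x : X) : E →L[ℝ] E :=
  (trivializationAt E (TangentSpace 𝓘(ℝ, E) : X → Type _) x₀).symmL ℝ x

variable (E) in
/-- The coordinates of tangent vectors at `x` in the preferred chart at `x₀`, as a map `TₓX → E`. -/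
def tangentCoframe (x₀ x : X) : E →L[ℝ] E :=
  (trivializationAt E (TangentSpace 𝓘(ℝ, E) : X → Type _) x₀).continuousLinearMapAt ℝ x

theorem tangentFrame_coframe {x₀ x : X} (hx : x ∈ (chartAt E x₀).source) (v : E) :
    tangentFrame E x₀ x (tangentCoframe E x₀ x v) = v :=
  (trivializationAt E (TangentSpace 𝓘(ℝ, E) : X → Type _) x₀).symmL_continuousLinearMapAt
    (by simpa using hx) v

theorem tangentCoframe_frame {x₀ x : X} (hx : x ∈ (chartAt E x₀).source) (v : E) :
    tangentCoframe E x₀ x (tangentFrame E x₀ x v) = v :=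
  (trivializationAt E (TangentSpace 𝓘(ℝ, E) : X → Type _) x₀).continuousLinearMapAt_symmL
    (by simpa using hx) v

/-- A field of bilinear forms is smooth if and only if its components in a coordinate frame are. -/
theorem isSmoothFormAt_iff {β : X → E →L[ℝ] E →L[ℝ] ℝ} {x₀ : X} :
    IsSmoothFormAt β x₀ ↔ ContMDiffAt 𝓘(ℝ, E) 𝓘(ℝ, E →L[ℝ] E →L[ℝ] ℝ) ∞
        (fun x ↦ pullForm (β x) (tangentFrame E x₀ x)) x₀ := by
  rw [IsSmoothFormAt, contMDiffAt_hom_bundle]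
  refine (and_iff_right contMDiffAt_id).trans (Filter.EventuallyEq.contMDiffAt_iff ?_)
  filter_upwards [chart_source_mem_nhds E x₀] with x hx
  ext v w
  have hbase : x ∈ (trivializationAt E (TangentSpace 𝓘(ℝ, E) : X → Type _) x₀).baseSet := by
    simpa using hx
  have hs : ∀ u : E, (trivializationAt E (TangentSpace 𝓘(ℝ, E) : X → Type _) x₀).symm x u =
      tangentFrame E x₀ x u := fun u ↦ (Trivialization.symmL_apply _ hbase u).symm
  refine (inCoordinates_apply_eq₂ hbase hbase (by simp)).trans ?_
  rw [hs, hs]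
  exact LinearMap.congr_fun (Trivial.linearMapAt_trivialization ℝ X ℝ x) _

/-- The differential of a smooth map is smooth, in coordinate frames. -/
theorem contMDiffAt_differential_coordinates {f : X → Y} {x₀ : X}
    (hf : ContMDiffAt 𝓘(ℝ, E) 𝓘(ℝ, F) ∞ f x₀) :
    ContMDiffAt 𝓘(ℝ, E) 𝓘(ℝ, E →L[ℝ] F) ∞
      (fun x ↦ tangentCoframe F (f x₀) (f x) ∘L differential E F f x ∘L tangentFrame E x₀ x) x₀ :=
  hf.mfderiv_const (m := ∞) (by simp)

/-- The pullback of a smooth field of bilinear forms under a smooth map is smooth. -/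
theorem IsSmoothFormAt.pullback {f : X → Y} {x₀ : X} {β : Y → F →L[ℝ] F →L[ℝ] ℝ}
    (hβ : IsSmoothFormAt β (f x₀)) (hf : ContMDiffAt 𝓘(ℝ, E) 𝓘(ℝ, F) ∞ f x₀) :
    IsSmoothFormAt (fun x ↦ pullForm (β (f x)) (differential E F f x)) x₀ := by
  rw [isSmoothFormAt_iff]
  have h1 := (isSmoothFormAt_iff.1 hβ).comp x₀ hf
  have h3 := (contDiff_pullForm (E := E) (F := F)).contMDiff.contMDiffAt.comp x₀
    (h1.prodMk_space (contMDiffAt_differential_coordinates hf))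
  refine h3.congr_of_eventuallyEq ?_
  filter_upwards [hf.continuousAt.eventually_mem (chart_source_mem_nhds F (f x₀))] with x hx
  ext v w
  simp only [Function.comp_apply, pullForm_apply, ContinuousLinearMap.comp_apply]
  rw [tangentFrame_coframe hx, tangentFrame_coframe hx]

/-- If a field `b` of bilinear forms is, at the points `f x`, the push-forward of a smooth field of
inner products under a submersion `f`, then it is smooth. -/
theorem IsSmoothFormAt.pushForward [FiniteDimensional ℝ E] [FiniteDimensional ℝ F]
    {f : X → Y} {x₀ : X} {β : X → E →L[ℝ] E →L[ℝ] ℝ} (hβ : IsSmoothFormAt β x₀)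
    (hβi : ∀ x, IsInnerForm (β x)) (hf : ContMDiffAt 𝓘(ℝ, E) 𝓘(ℝ, F) ∞ f x₀)
    (hf' : ∀ x, Function.Surjective (differential E F f x)) {b : Y → F →L[ℝ] F →L[ℝ] ℝ}
    (hb : ∀ x, b (f x) = pushForm (β x) (differential E F f x)) :
    IsSmoothFormAt b (f x₀) := by
  obtain ⟨s, hs0, hs, hsec⟩ := exists_local_section hf (hf' x₀)
  rw [isSmoothFormAt_iff] at hβ ⊢
  let C : X → E →L[ℝ] E →L[ℝ] ℝ := fun x ↦ pullForm (β x) (tangentFrame E x₀ x)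
  let A : X → E →L[ℝ] F := fun x ↦
    tangentCoframe F (f x₀) (f x) ∘L differential E F f x ∘L tangentFrame E x₀ x
  have hC : ContMDiffAt 𝓘(ℝ, E) 𝓘(ℝ, E →L[ℝ] E →L[ℝ] ℝ) ∞ C (s (f x₀)) := by rwa [hs0]
  have hA : ContMDiffAt 𝓘(ℝ, E) 𝓘(ℝ, E →L[ℝ] F) ∞ A (s (f x₀)) := by
    rw [hs0]
    exact contMDiffAt_differential_coordinates hf
  -- near `x₀` the components of the forms and of the differential are those of inner products
  -- and of surjective maps
  have hframe : ∀ {x}, x ∈ (chartAt E x₀).source → IsInnerForm (C x) := fun {x} hx ↦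
    (hβi x).pull fun v hv ↦ by rw [← tangentCoframe_frame hx v, hv, map_zero]
  have hsurj : ∀ {x}, x ∈ (chartAt E x₀).source → f x ∈ (chartAt F (f x₀)).source →
      Function.Surjective (A x) := fun {x} hx hfx y ↦ by
    obtain ⟨v, hv⟩ := hf' x (tangentFrame F (f x₀) (f x) y)
    refine ⟨tangentCoframe E x₀ x v, ?_⟩
    simp only [A, ContinuousLinearMap.comp_apply]
    rw [tangentFrame_coframe hx, hv, tangentCoframe_frame hfx]
  have hpush : ContMDiffAt 𝓘(ℝ, F) 𝓘(ℝ, F →L[ℝ] F →L[ℝ] ℝ) ∞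
      (fun y ↦ pushForm (C (s y)) (A (s y))) (f x₀) := by
    have h0 : ContDiffAt ℝ ∞
        (fun p : (E →L[ℝ] E →L[ℝ] ℝ) × (E →L[ℝ] F) ↦ pushForm p.1 p.2)
        (C (s (f x₀)), A (s (f x₀))) := by
      rw [hs0]
      exact (hframe (mem_chart_source E x₀)).contDiffAt_pushForm
        (hsurj (mem_chart_source E x₀) (mem_chart_source F (f x₀)))
    have h1 : ContMDiffAt 𝓘(ℝ, F) 𝓘(ℝ, (E →L[ℝ] E →L[ℝ] ℝ) × (E →L[ℝ] F)) ∞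
        (fun y ↦ (C (s y), A (s y))) (f x₀) :=
      (hC.comp (f x₀) hs).prodMk_space (hA.comp (f x₀) hs)
    exact ContMDiffAt.comp (f x₀)
      (g := fun p : (E →L[ℝ] E →L[ℝ] ℝ) × (E →L[ℝ] F) ↦ pushForm p.1 p.2) h0.contMDiffAt h1
  refine hpush.congr_of_eventuallyEq ?_
  have hsrc : ∀ᶠ y in 𝓝 (f x₀), s y ∈ (chartAt E x₀).source :=
    hs.continuousAt.eventually_mem (by rw [hs0]; exact chart_source_mem_nhds E x₀)
  filter_upwards [hsrc, hsec, chart_source_mem_nhds F (f x₀)] with y hy hfy hy'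
  have hfy' : f (s y) ∈ (chartAt F (f x₀)).source := by rwa [hfy]
  have hnat := (hframe hy).pushForm_natural (hsurj hy hfy') (hβi (s y)) (hf' (s y))
    (tangentFrame E x₀ (s y)) (tangentFrame F (f x₀) (f (s y)))
    (fun v _ ↦ ⟨_, tangentFrame_coframe hy v⟩)
    (fun v hv ↦ by rw [← tangentCoframe_frame hfy' v, hv, map_zero])
    (fun v w ↦ rfl) (fun v ↦ (tangentFrame_coframe hfy' _).symm)
  rw [← hnat, ← hb, hfy]

/-- On a vector space, smoothness of a field of bilinear forms has its elementary meaning. -/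
theorem IsSmoothFormAt.contDiffAt {b : F → F →L[ℝ] F →L[ℝ] ℝ} {y₀ : F}
    (hb : IsSmoothFormAt b y₀) : ContDiffAt ℝ ∞ b y₀ := by
  rw [isSmoothFormAt_iff] at hb
  have hfr : ∀ y, tangentFrame F y₀ y = ContinuousLinearMap.id ℝ F :=
    TangentBundle.symmL_model_space y₀
  simp only [hfr] at hb
  exact contMDiffAt_iff_contDiffAt.1 hb

end Forms

/-! ### Riemannian submersions and push-forwards -/

section RiemannianSubmersions

open Filter Topology

variable {E : Type*} [NormedAddCommGroup E] [NormedSpace ℝ E] [FiniteDimensional ℝ E]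
  {X : Type*} [TopologicalSpace X] [ChartedSpace E X]
  {F : Type*} [NormedAddCommGroup F] [NormedSpace ℝ F] [FiniteDimensional ℝ F]
  {Y : Type*} [TopologicalSpace Y] [ChartedSpace F Y]

/-- A submersion is riemannian if and only if the metric on its target is, at each point of the
image, the push-forward of the metric at any point of the fibre. -/
theorem isRiemannianSubmersion_iff {β : X → E →L[ℝ] E →L[ℝ] ℝ} (hβ : ∀ x, IsInnerForm (β x))
    {b : Y → F →L[ℝ] F →L[ℝ] ℝ} {f : X → Y} :
    IsRiemannianSubmersion (E := E) (F := F) (fun x v w ↦ β x v w) (fun y v w ↦ b y v w) f ↔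
      ContMDiff 𝓘(ℝ, E) 𝓘(ℝ, F) ∞ f ∧ (∀ x, Function.Surjective (differential E F f x)) ∧
        ∀ x, b (f x) = pushForm (β x) (differential E F f x) := by
  constructor
  · rintro ⟨h1, h2, h3⟩
    exact ⟨h1, h2, fun x ↦
      (hβ x).eq_pushForm (F := F) (A := differential E F f x) (h2 x) (h3 x)⟩
  · rintro ⟨h1, h2, h3⟩
    refine ⟨h1, h2, fun x v w hv _ ↦ ?_⟩
    have h := (hβ x).pushForm_apply (h2 x) hv w
    rw [← h3 x] at h
    exact h

/-- For a smooth field of inner products and a submersion `f` to a vector space, the smoothness,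
the symmetry and the positivity of a reduced metric are automatic. -/
theorem isReducedMetric_iff [IsManifold 𝓘(ℝ, E) ∞ X] {β : X → E →L[ℝ] E →L[ℝ] ℝ}
    (hβ : ∀ x, IsInnerForm (β x)) (hβs : ∀ x, IsSmoothFormAt β x)
    {b : F → F →L[ℝ] F →L[ℝ] ℝ} {f : X → F} :
    IsReducedMetric (E := E) (fun x v w ↦ β x v w) f b ↔
      ContMDiff 𝓘(ℝ, E) 𝓘(ℝ, F) ∞ f ∧ (∀ x, Function.Surjective (differential E F f x)) ∧
        ∀ x, b (f x) = pushForm (β x) (differential E F f x) := by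
  constructor
  · intro h
    exact (isRiemannianSubmersion_iff hβ).1 h.submersion
  · rintro ⟨h1, h2, h3⟩
    have hinner : ∀ x, IsInnerForm (b (f x)) := fun x ↦ by
      rw [h3 x]
      exact (hβ x).push (h2 x)
    refine ⟨isOpen_range_of_surjective_mfderiv h1 h2, ?_, ?_, ?_,
      (isRiemannianSubmersion_iff hβ).2 ⟨h1, h2, h3⟩⟩
    · rintro _ ⟨x, rfl⟩
      exact ((hβs x).pushForward hβ (h1 x) h2 h3).contDiffAt.contDiffWithinAt
    · rintro _ ⟨x, rfl⟩
      exact (hinner x).symm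
    · rintro _ ⟨x, rfl⟩
      exact (hinner x).pos

omit [FiniteDimensional ℝ E] [FiniteDimensional ℝ F] in
/-- A field of push-forwards which is constant along the fibres of `f` descends to the target. -/
theorem exists_eq_pushForm {β : X → E →L[ℝ] E →L[ℝ] ℝ} {f : X → Y}
    (h : ∀ x x', f x = f x' →
      pushForm (β x) (differential E F f x) = pushForm (β x') (differential E F f x')) :
    ∃ b : Y → F →L[ℝ] F →L[ℝ] ℝ, ∀ x, b (f x) = pushForm (β x) (differential E F f x) :=
  ⟨Function.extend f (fun x ↦ pushForm (β x) (differential E F f x)) 0,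
    fun x ↦ Function.FactorsThrough.extend_apply (fun x x' hx ↦ h x x' hx) _ x⟩

/-- An isometric diffeomorphism `φ` with inverse `ψ` which preserves `f` does not change the
push-forward along `f`. -/
theorem pushForm_eq_of_symmetry {β : X → E →L[ℝ] E →L[ℝ] ℝ} (hβ : ∀ x, IsInnerForm (β x))
    {f : X → Y} (hf : ContMDiff 𝓘(ℝ, E) 𝓘(ℝ, F) ∞ f)
    (hf' : ∀ x, Function.Surjective (differential E F f x)) {φ ψ : X → X}
    (hφ : ContMDiff 𝓘(ℝ, E) 𝓘(ℝ, E) ∞ φ) (hψ : ContMDiff 𝓘(ℝ, E) 𝓘(ℝ, E) ∞ ψ)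
    (hφψ : φ ∘ ψ = id) (hψφ : ψ ∘ φ = id) (hfφ : f ∘ φ = f)
    (hiso : ∀ x v w, β (φ x) (differential E E φ x v) (differential E E φ x w) = β x v w) (x : X) :
    pushForm (β (φ x)) (differential E F f (φ x)) = pushForm (β x) (differential E F f x) := by
  have hcomp : differential E F f x = differential E F f (φ x) ∘L differential E E φ x := by
    rw [← (hf (φ x)).differential_comp (hφ x), hfφ]
  have hsurj : Function.Surjective (differential E E φ x) := fun v ↦ by
    have hx : ψ (φ x) = x := congrFun hψφ x
    have hφ' : ContMDiffAt 𝓘(ℝ, E) 𝓘(ℝ, E) ∞ φ (ψ (φ x)) := hφ _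
    have h := hφ'.differential_comp (hψ (φ x))
    rw [hφψ, differential_id, hx] at h
    exact ⟨differential E E ψ (φ x) v, (DFunLike.congr_fun h v).symm⟩
  refine (hβ x).pushForm_natural (hf' x) (hβ (φ x)) (hf' (φ x)) (differential E E φ x)
    (ContinuousLinearMap.id ℝ F) (fun v _ ↦ hsurj v) (fun _ h ↦ h) (hiso x) fun v ↦ ?_
  rw [hcomp]
  rfl

end RiemannianSubmersions

/-! ### Smooth metrics as fields of inner products -/

section Metrics

variable {E : Type*} [NormedAddCommGroup E] [NormedSpace ℝ E]
  {X : Type*} [TopologicalSpace X] [ChartedSpace E X] [IsManifold 𝓘(ℝ, E) ∞ X]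

/-- The metric as a field of bilinear forms on the model space. -/
def SmoothMetric.form (g : SmoothMetric E X) (x : X) : E →L[ℝ] E →L[ℝ] ℝ := g.inner x

theorem SmoothMetric.isInnerForm (g : SmoothMetric E X) (x : X) : IsInnerForm (g.form x) :=
  ⟨g.symm x, g.pos x⟩

theorem SmoothMetric.isSmoothFormAt (g : SmoothMetric E X) (x : X) : IsSmoothFormAt g.form x :=
  g.contMDiff x

theorem SmoothMetric.form_injective :
    Function.Injective (SmoothMetric.form : SmoothMetric E X → X → E →L[ℝ] E →L[ℝ] ℝ) := by
  rintro ⟨g, _, _, _, _⟩ ⟨g', _, _, _, _⟩ h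
  have : g = g' := h
  subst this
  rfl

/-- A smooth field of inner products on a finite-dimensional manifold is a smooth metric. -/
def SmoothMetric.ofForm [FiniteDimensional ℝ E] (β : X → E →L[ℝ] E →L[ℝ] ℝ)
    (hβ : ∀ x, IsInnerForm (β x)) (hβs : ∀ x, IsSmoothFormAt β x) : SmoothMetric E X where
  inner := β
  symm x := (hβ x).symm
  pos x := (hβ x).pos
  isVonNBounded x := (hβ x).isVonNBounded
  contMDiff := hβs

end Metrics

/-! ### Free actions and momentum maps -/

section Actions

open Filter Topology Bundle

variable {EG : Type*} [NormedAddCommGroup EG] [NormedSpace ℝ EG] [FiniteDimensional ℝ EG]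
  {G : Type*} [Group G] [TopologicalSpace G] [ChartedSpace EG G] [LieGroup 𝓘(ℝ, EG) ∞ G]
  {E : Type*} [NormedAddCommGroup E] [NormedSpace ℝ E]
  {X : Type*} [TopologicalSpace X] [ChartedSpace E X]
  [IsManifold 𝓘(ℝ, E) ∞ X] [MulAction G X] [ContMDiffSMul 𝓘(ℝ, EG) 𝓘(ℝ, E) ∞ G X]

omit [FiniteDimensional ℝ EG] [LieGroup 𝓘(ℝ, EG) ∞ G] [IsManifold 𝓘(ℝ, E) ∞ X] in
variable (EG E) in
theorem contMDiff_orbitMap (z : X) : ContMDiff 𝓘(ℝ, EG) 𝓘(ℝ, E) ∞ (fun g : G ↦ g • z) :=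
  contMDiff_id.smul (I := 𝓘(ℝ, EG)) contMDiff_const

/-- A free action is infinitesimally free: if `X_ξ` vanishes at `z` then the integral curve through
`1` of the left invariant vector field of `ξ` fixes `z`, so it is constant. -/
theorem eq_zero_of_fundamentalField_eq_zero (hfree : ∀ (g : G) (z : X), g • z = z → g = 1)
    {ξ : EG} {z : X} (hξ : fundamentalField G E ξ z = 0) : ξ = 0 := by
  have : CompleteSpace EG := FiniteDimensional.complete ℝ EG
  have : LieGroup 𝓘(ℝ, EG) (minSmoothness ℝ 3) G := by
    rw [minSmoothness_of_isRCLikeNormedField]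
    infer_instance
  have hV := contMDiff_mulInvariantVectorField (I := 𝓘(ℝ, EG)) (G := G) ξ
  obtain ⟨γ, hγ0, hγ⟩ := exists_isMIntegralCurveAt_of_contMDiffAt_boundaryless (I := 𝓘(ℝ, EG))
    (v := mulInvariantVectorField (I := 𝓘(ℝ, EG)) (G := G) ξ) (x₀ := (1 : G)) 0
    ((hV 1).of_le (by rw [minSmoothness_of_isRCLikeNormedField]; norm_num))
  have horb := contMDiff_orbitMap EG E (G := G) z
  -- the action of `g` carries `X_ξ(z)` to the velocity of `t ↦ γ t • z` at a point with `γ t = g`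
  have hzero : ∀ g : G, mfderiv 𝓘(ℝ, EG) 𝓘(ℝ, E) (fun h : G ↦ h • z) g
      (mulInvariantVectorField (I := 𝓘(ℝ, EG)) (G := G) ξ g) = 0 := by
    intro g
    have h1 : differential EG E (fun h : G ↦ h • z) g ∘L differential EG EG (fun h : G ↦ g * h) 1 =
        differential E E (fun x : X ↦ g • x) z ∘L differential EG E (fun h : G ↦ h • z) 1 := by
      have hl : ContMDiffAt 𝓘(ℝ, EG) 𝓘(ℝ, EG) ∞ (fun h : G ↦ g * h) 1 := contMDiff_mul_left 1
      have ho : ContMDiffAt 𝓘(ℝ, EG) 𝓘(ℝ, E) ∞ (fun h : G ↦ h • z) ((fun h : G ↦ g * h) 1) :=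
        horb _
      have hs : ContMDiffAt 𝓘(ℝ, E) 𝓘(ℝ, E) ∞ (fun x : X ↦ g • x) ((fun h : G ↦ h • z) 1) :=
        ContMDiffSMul.contMDiff_const_smul (I := 𝓘(ℝ, EG)) g _
      have e1 := ho.differential_comp hl
      have e2 := hs.differential_comp (f := fun h : G ↦ h • z) (x := 1) (horb 1)
      simp only [mul_one, one_smul] at e1 e2
      rw [← e1, ← e2]
      congr 1
      ext h
      simp [mul_smul]
    have h2 : differential EG E (fun h : G ↦ h • z) 1 ξ = 0 := hξ
    have h3 := DFunLike.congr_fun h1 ξ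
    rw [ContinuousLinearMap.comp_apply, ContinuousLinearMap.comp_apply, h2, map_zero] at h3
    exact h3
  have hcurve : IsMIntegralCurveAt (I := 𝓘(ℝ, E)) (fun t ↦ γ t • z) (fun _ : X ↦ 0) 0 := by
    filter_upwards [hγ] with t ht
    have h1 := ((horb (γ t)).mdifferentiableAt (by simp)).hasMFDerivAt.comp t ht
    have h2 : ∀ (L : EG →L[ℝ] E) (w : EG) (s : ℝ), L w = 0 → L (s • w) = s • (0 : E) :=
      fun L w s hw ↦ by rw [map_smul, hw]
    exact h1.congr_mfderiv (ContinuousLinearMap.ext fun s ↦ h2 _ _ s (hzero (γ t)))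
  have hconst : IsMIntegralCurveAt (I := 𝓘(ℝ, E)) (fun _ : ℝ ↦ z) (fun _ : X ↦ 0) 0 := by
    refine Filter.Eventually.of_forall fun t ↦ ?_
    refine (hasMFDerivAt_const (I := 𝓘(ℝ, ℝ)) (I' := 𝓘(ℝ, E)) z t).congr_mfderiv
      (ContinuousLinearMap.ext fun (s : ℝ) ↦ ?_)
    exact (smul_zero (A := E) s).symm
  have hev := isMIntegralCurveAt_eventuallyEq_of_contMDiffAt_boundaryless (I := 𝓘(ℝ, E))
    (contMDiff_zeroSection ℝ (TangentSpace 𝓘(ℝ, E) : X → Type _) _) hcurve hconst (by simp [hγ0])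
  have hγ1 : γ =ᶠ[𝓝 0] fun _ ↦ 1 := hev.mono fun t ht ↦ hfree _ _ ht
  have hd := hasMFDerivAt_unique hγ.hasMFDerivAt ((hasMFDerivAt_const (I := 𝓘(ℝ, ℝ))
    (I' := 𝓘(ℝ, EG)) (1 : G) (0 : ℝ)).congr_of_eventuallyEq hγ1)
  have hV0 : differential EG EG (fun h : G ↦ γ 0 * h) 1 ξ = 0 :=
    (one_smul ℝ (differential EG EG (fun h : G ↦ γ 0 * h) 1 ξ)).symm.trans
      (DFunLike.congr_fun hd (1 : ℝ))
  have hid : (fun h : G ↦ γ 0 * h) = id := by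
    ext h
    simp [hγ0]
  rwa [hid, differential_id] at hV0

end Actions

section MomentumMaps

open Filter Topology Bundle

variable {EG : Type*} [NormedAddCommGroup EG] [NormedSpace ℝ EG] [FiniteDimensional ℝ EG]
  {G : Type*} [Group G] [TopologicalSpace G] [ChartedSpace EG G] [LieGroup 𝓘(ℝ, EG) ∞ G]
  {E : Type*} [NormedAddCommGroup E] [NormedSpace ℝ E]
  {X : Type*} [TopologicalSpace X] [ChartedSpace E X]
  [IsManifold 𝓘(ℝ, E) ∞ X] [MulAction G X] [ContMDiffSMul 𝓘(ℝ, EG) 𝓘(ℝ, E) ∞ G X]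

/-- The momentum map of a free action is a submersion: the annihilator of the image of its
differential consists of the Lie algebra elements whose fundamental field vanishes. -/
theorem IsMomentumMap.differential_surjective
    {Ω : ∀ x : X, TangentSpace 𝓘(ℝ, E) x →L[ℝ] TangentSpace 𝓘(ℝ, E) x →L[ℝ] ℝ}
    (hΩ : IsSymplecticForm Ω) {μ : X → StrongDual ℝ EG} (hμ : IsMomentumMap G Ω μ)
    (hfree : ∀ (g : G) (z : X), g • z = z → g = 1) (z : X) :
    Function.Surjective (differential E (StrongDual ℝ EG) μ z) := by
  set A := differential E (StrongDual ℝ EG) μ z with hA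
  by_contra hns
  have hlt : (A : E →ₗ[ℝ] StrongDual ℝ EG).range < ⊤ :=
    lt_top_iff_ne_top.2 fun h ↦ hns (LinearMap.range_eq_top.1 h)
  obtain ⟨f, hf0, hf⟩ := Submodule.exists_le_ker_of_lt_top _ hlt
  -- by reflexivity, the functional `f` is the evaluation at an element `ξ` of the Lie algebra
  obtain ⟨ξ, hξ⟩ : ∃ ξ : EG, ∀ α : StrongDual ℝ EG, f α = α ξ := by
    let e := LinearMap.toContinuousLinearMap (𝕜 := ℝ) (E := EG) (F' := ℝ)
    obtain ⟨ξ, hξ⟩ := (Module.evalEquiv ℝ EG).surjective (f ∘ₗ e.toLinearMap)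
    refine ⟨ξ, fun α ↦ ?_⟩
    have h := LinearMap.congr_fun hξ (α : EG →ₗ[ℝ] ℝ)
    exact h.symm
  have hX : fundamentalField G E ξ z = 0 := by
    refine hΩ.nondegenerate z _ fun v ↦ ?_
    have h1 : Ω z (fundamentalField G E ξ z) v = -(A v) ξ := hμ.hamiltonian ξ z v
    have h2 : f (A v) = 0 := hf ⟨v, rfl⟩
    rw [h1, ← hξ, h2, neg_zero]
  have hξ0 : ξ = 0 := eq_zero_of_fundamentalField_eq_zero (E := E) hfree hX
  refine hf0 (LinearMap.ext fun α ↦ ?_)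
  rw [hξ, hξ0, map_zero]
  rfl

/-- If `μ` is a submersion which is constant on the orbits of a free action of `G`, and `G` has half
the dimension of the manifold, then the kernel of the differential of `μ` consists of the values of
the fundamental fields. -/
theorem exists_fundamentalField_eq [FiniteDimensional ℝ E]
    (hfree : ∀ (g : G) (z : X), g • z = z → g = 1)
    (hdim : 2 * Module.finrank ℝ EG = Module.finrank ℝ E)
    {μ : X → StrongDual ℝ EG} (hμ : ContMDiff 𝓘(ℝ, E) 𝓘(ℝ, StrongDual ℝ EG) ∞ μ)
    (hfib : FibresAreOrbits G μ) {z : X}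
    (hsurj : Function.Surjective (differential E (StrongDual ℝ EG) μ z)) {v : E}
    (hv : differential E (StrongDual ℝ EG) μ z v = 0) :
    ∃ ξ : EG, differential EG E (fun g : G ↦ g • z) 1 ξ = v := by
  set A := differential E (StrongDual ℝ EG) μ z with hA
  set O := differential EG E (fun g : G ↦ g • z) 1 with hO
  have hinj : Function.Injective (O : EG →ₗ[ℝ] E) := by
    rw [injective_iff_map_eq_zero]
    intro ξ hξ
    exact eq_zero_of_fundamentalField_eq_zero (E := E) (z := z) hfree hξ
  have hle : (O : EG →ₗ[ℝ] E).range ≤ (A : E →ₗ[ℝ] StrongDual ℝ EG).ker := by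
    rintro _ ⟨ξ, rfl⟩
    have hμ1 : ContMDiffAt 𝓘(ℝ, E) 𝓘(ℝ, StrongDual ℝ EG) ∞ μ ((fun g : G ↦ g • z) 1) := hμ _
    have h := hμ1.differential_comp (f := fun g : G ↦ g • z) (x := 1)
      (contMDiff_orbitMap EG E (G := G) z 1)
    have hc : μ ∘ (fun g : G ↦ g • z) = fun _ ↦ μ z := by
      ext1 g
      exact ((hfib z (g • z)).2 ⟨g, rfl⟩).symm
    have h0 : differential EG (StrongDual ℝ EG) (fun _ : G ↦ μ z) 1 = 0 := mfderiv_const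
    rw [hc, h0] at h
    simp only [one_smul] at h
    exact (DFunLike.congr_fun h ξ).symm
  have hfin : Module.finrank ℝ (O : EG →ₗ[ℝ] E).range =
      Module.finrank ℝ (A : E →ₗ[ℝ] StrongDual ℝ EG).ker := by
    have h1 := (A : E →ₗ[ℝ] StrongDual ℝ EG).finrank_range_add_finrank_ker
    rw [LinearMap.range_eq_top.2 hsurj, finrank_top,
      ← (LinearMap.toContinuousLinearMap (𝕜 := ℝ) (E := EG) (F' := ℝ)).finrank_eq] at h1
    have h2 : Module.finrank ℝ (EG →ₗ[ℝ] ℝ) = Module.finrank ℝ EG := Subspace.dual_finrank_eq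
    rw [LinearMap.finrank_range_of_inj hinj]
    omega
  have hmem : v ∈ (O : EG →ₗ[ℝ] E).range := by
    rw [Submodule.eq_of_le_of_finrank_eq hle hfin]
    exact hv
  exact hmem

end MomentumMaps

/-! ### Embedded subsets -/

section Embedded

open Filter Topology

variable {E : Type*} [NormedAddCommGroup E] [NormedSpace ℝ E]
  {X : Type*} [TopologicalSpace X] [ChartedSpace E X]
  {Z : Set X} {EZ : Type*} [NormedAddCommGroup EZ] [NormedSpace ℝ EZ] [ChartedSpace EZ Z]
  {F : Type*} [NormedAddCommGroup F] [NormedSpace ℝ F]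
  {W : Type*} [TopologicalSpace W] [ChartedSpace F W]

/-- A smooth map to the ambient manifold with values in an embedded submanifold is smooth as a map
to the submanifold. -/
theorem ContMDiff.codRestrict_of_isSmoothEmbedding
    [IsManifold 𝓘(ℝ, EZ) ∞ Z] [IsManifold 𝓘(ℝ, E) ∞ X] [IsManifold 𝓘(ℝ, F) ∞ W]
    (hZ : Manifold.IsSmoothEmbedding 𝓘(ℝ, EZ) 𝓘(ℝ, E) ∞ (Subtype.val : Z → X)) {h : W → Z}
    (hh : ContMDiff 𝓘(ℝ, F) 𝓘(ℝ, E) ∞ (fun w ↦ (h w : X))) :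
    ContMDiff 𝓘(ℝ, F) 𝓘(ℝ, EZ) ∞ h :=
  (ContMDiff.iff_comp_isImmersion hZ.isImmersion).2
    ⟨hZ.isEmbedding.continuous_iff.2 hh.continuous, hh⟩

/-- The tangent spaces of an embedded submanifold contain the images of the differentials of the
smooth maps which take values in it. -/
theorem exists_differential_val_eq
    [IsManifold 𝓘(ℝ, EZ) ∞ Z] [IsManifold 𝓘(ℝ, E) ∞ X] [IsManifold 𝓘(ℝ, F) ∞ W]
    (hZ : Manifold.IsSmoothEmbedding 𝓘(ℝ, EZ) 𝓘(ℝ, E) ∞ (Subtype.val : Z → X)) {h : W → X}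
    {w : W} (hh : ContMDiffAt 𝓘(ℝ, F) 𝓘(ℝ, E) ∞ h w) (hhZ : ∀ᶠ w' in 𝓝 w, h w' ∈ Z) {z : Z}
    (hz : h w = z) (v : F) :
    ∃ u : EZ, differential EZ E (Subtype.val : Z → X) z u = differential F E h w v := by
  classical
  let κ : W → Z := fun w' ↦ if hw : h w' ∈ Z then ⟨h w', hw⟩ else z
  have hκw : κ w = z := by
    ext
    simp [κ, hz]
  have hκ : (Subtype.val ∘ κ) =ᶠ[𝓝 w] h := by
    filter_upwards [hhZ] with w' hw'
    simp [κ, hw']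
  have hκs' : ContMDiffAt 𝓘(ℝ, F) 𝓘(ℝ, E) ∞ (Subtype.val ∘ κ) w := hh.congr_of_eventuallyEq hκ
  have hκs : ContMDiffAt 𝓘(ℝ, F) 𝓘(ℝ, EZ) ∞ κ w :=
    (ContMDiffAt.iff_comp_isImmersionAt (hZ.isImmersion.isImmersionAt _)).2
      ⟨hZ.isEmbedding.isInducing.continuousAt_iff.2 hκs'.continuousAt, hκs'⟩
  have hcomp := (hZ.contMDiff (κ w)).differential_comp hκs
  have heq : differential F E (Subtype.val ∘ κ) w = differential F E h w :=
    hκ.mfderiv_eq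
  rw [heq, hκw] at hcomp
  exact ⟨differential F EZ κ w v, by rw [hcomp]; rfl⟩

end Embedded

/-! ### The momentum level and the reduced space -/

section Reduction

open Filter Topology

set_option linter.unusedSectionVars false

/-- A map out of the target of a surjective submersion `q` is smooth if its composition with `q`
is. -/
theorem contMDiff_of_comp_submersion
    {E : Type*} [NormedAddCommGroup E] [NormedSpace ℝ E] [FiniteDimensional ℝ E]
    {X : Type*} [TopologicalSpace X] [ChartedSpace E X] [IsManifold 𝓘(ℝ, E) ∞ X]
    {F : Type*} [NormedAddCommGroup F] [NormedSpace ℝ F] [FiniteDimensional ℝ F]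
    {Y : Type*} [TopologicalSpace Y] [ChartedSpace F Y]
    {V : Type*} [NormedAddCommGroup V] [NormedSpace ℝ V]
    {W : Type*} [TopologicalSpace W] [ChartedSpace V W]
    {q : X → Y} (hq : ContMDiff 𝓘(ℝ, E) 𝓘(ℝ, F) ∞ q)
    (hq' : ∀ x, Function.Surjective (differential E F q x)) (hqs : Function.Surjective q)
    {f : Y → W} (hf : ContMDiff 𝓘(ℝ, E) 𝓘(ℝ, V) ∞ (f ∘ q)) : ContMDiff 𝓘(ℝ, F) 𝓘(ℝ, V) ∞ f := by
  intro y
  obtain ⟨x, rfl⟩ := hqs y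
  obtain ⟨s, hs0, hs, hsec⟩ := exists_local_section (hq x) (hq' x)
  refine ((hf (s (q x))).comp (q x) hs).congr_of_eventuallyEq ?_
  filter_upwards [hsec] with y hy
  simp [hy]

section LinearEmbedding

variable {EG : Type*} [NormedAddCommGroup EG] [NormedSpace ℝ EG] [FiniteDimensional ℝ EG]
  {G : Type*} [Group G] [TopologicalSpace G] [ChartedSpace EG G]

variable (EG) in
/-- `u* : (𝔤/𝔫)* → 𝔤*` as a continuous linear map. -/
def uStarL (N : Subgroup G) : QuotDual EG N →L[ℝ] StrongDual ℝ EG :=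
  (lieAlgebraOf EG N).mkQL.precomp ℝ

theorem uStarL_injective (N : Subgroup G) (β : QuotDual EG N) (hβ : uStarL EG N β = 0) :
    β = 0 := by
  ext x
  obtain ⟨y, rfl⟩ := (lieAlgebraOf EG N).mkQ_surjective x
  exact DFunLike.congr_fun hβ y

theorem hasFDerivAt_affineEmb (N : Subgroup G) (c : StrongDual ℝ EG) (β : QuotDual EG N) :
    HasFDerivAt (affineEmb N c) (uStarL EG N) β := by
  have h : HasFDerivAt (uStarL EG N) (uStarL EG N) β :=
    ContinuousLinearMap.hasFDerivAt (𝕜 := ℝ) (E := QuotDual EG N) (F := StrongDual ℝ EG) _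
  have h' := HasFDerivAt.add_const (𝕜 := ℝ) (E := QuotDual EG N) (F := StrongDual ℝ EG) c h
  exact h'

theorem contDiff_affineEmb (N : Subgroup G) (c : StrongDual ℝ EG) :
    ContDiff ℝ ∞ (affineEmb N c : QuotDual EG N → StrongDual ℝ EG) :=
  ContDiff.add (ContinuousLinearMap.contDiff (𝕜 := ℝ) (E := QuotDual EG N)
    (F := StrongDual ℝ EG) (uStarL EG N)) contDiff_const

theorem differential_affineEmb (N : Subgroup G) (c : StrongDual ℝ EG) (β : QuotDual EG N) :
    differential (QuotDual EG N) (StrongDual ℝ EG) (affineEmb N c) β = uStarL EG N :=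
  mfderiv_eq_fderiv.trans (hasFDerivAt_affineEmb N c β).fderiv

theorem iStar_affineEmb (N : Subgroup G) (c : StrongDual ℝ EG) (β : QuotDual EG N) :
    iStar EG N (affineEmb N c β) = iStar EG N c := by
  ext ξ
  have h : (lieAlgebraOf EG N).mkQ (ξ : EG) = 0 := by simp
  have h' : β ((lieAlgebraOf EG N).mkQ (ξ : EG)) = 0 := by rw [h, map_zero]
  simpa [iStar, affineEmb, uStar] using h'

end LinearEmbedding

variable {EG : Type*} [NormedAddCommGroup EG] [NormedSpace ℝ EG] [FiniteDimensional ℝ EG]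
  {G : Type*} [Group G] [TopologicalSpace G] [ChartedSpace EG G] [LieGroup 𝓘(ℝ, EG) ∞ G]
  {E : Type*} [NormedAddCommGroup E] [NormedSpace ℝ E] [FiniteDimensional ℝ E]
  {X : Type*} [TopologicalSpace X] [ChartedSpace E X]
  [IsManifold 𝓘(ℝ, E) ∞ X] [MulAction G X] [ContMDiffSMul 𝓘(ℝ, EG) 𝓘(ℝ, E) ∞ G X]
  {μ : X → StrongDual ℝ EG} {N : Subgroup G} {c : StrongDual ℝ EG}
  {EZ : Type*} [NormedAddCommGroup EZ] [NormedSpace ℝ EZ] [FiniteDimensional ℝ EZ]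
  [ChartedSpace EZ (momentumLevel N μ c)] [IsManifold 𝓘(ℝ, EZ) ∞ (momentumLevel N μ c)]

/-- The tangent spaces of the momentum level contain the vectors which the differential of `μ` maps
to the image of `u*`. They are sums of a vector tangent to a local section of `μ` over the image
of `ℓ` and of a vector tangent to a `G`-orbit. -/
theorem exists_differential_val_eq_of_differential_eq_uStarL
    (hfree : ∀ (g : G) (z : X), g • z = z → g = 1)
    (hdim : 2 * Module.finrank ℝ EG = Module.finrank ℝ E)
    (hμ : ContMDiff 𝓘(ℝ, E) 𝓘(ℝ, StrongDual ℝ EG) ∞ μ) (hfib : FibresAreOrbits G μ)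
    (hμs : ∀ x, Function.Surjective (differential E (StrongDual ℝ EG) μ x))
    (hZ : Manifold.IsSmoothEmbedding 𝓘(ℝ, EZ) 𝓘(ℝ, E) ∞ (Subtype.val : momentumLevel N μ c → X))
    (z : momentumLevel N μ c) {v : E} {β : QuotDual EG N}
    (hv : differential E (StrongDual ℝ EG) μ z v = uStarL EG N β) :
    ∃ u : EZ, differential EZ E (Subtype.val : momentumLevel N μ c → X) z u = v := by
  obtain ⟨s, hs0, hs, hsec⟩ := exists_local_section (hμ z) (hμs z)
  set β₀ := reducedMomentum N μ c hfib (reducedProj N μ c z) with hβ₀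
  have hℓ : affineEmb N c β₀ = μ z := affineEmb_reducedMomentum N μ c hfib z
  have hℓs : ContMDiffAt 𝓘(ℝ, QuotDual EG N) 𝓘(ℝ, StrongDual ℝ EG) ∞ (affineEmb N c) β₀ :=
    (contDiff_affineEmb N c).contMDiff _
  rw [← hℓ] at hs hs0 hsec
  have hsℓ : ContMDiffAt 𝓘(ℝ, QuotDual EG N) 𝓘(ℝ, E) ∞ (s ∘ affineEmb N c) β₀ := hs.comp β₀ hℓs
  have hsecℓ : μ ∘ (s ∘ affineEmb N c) =ᶠ[𝓝 β₀] affineEmb N c := hℓs.continuousAt.eventually hsec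
  have hlevel : ∀ᶠ β in 𝓝 β₀, (s ∘ affineEmb N c) β ∈ momentumLevel N μ c := by
    filter_upwards [hsecℓ] with β hβ
    have hβ' : μ ((s ∘ affineEmb N c) β) = affineEmb N c β := hβ
    show iStar EG N (μ _) = iStar EG N c
    rw [hβ', iStar_affineEmb]
  -- subtracting a vector tangent to the section over the image of `ℓ` leaves one tangent to an orbit
  obtain ⟨u₁, hu₁⟩ := exists_differential_val_eq hZ hsℓ hlevel hs0 β
  set v₁ := differential (QuotDual EG N) E (s ∘ affineEmb N c) β₀ β with hv₁
  have hμv₁ : differential E (StrongDual ℝ EG) μ z v₁ = uStarL EG N β := by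
    have h := (hμ ((s ∘ affineEmb N c) β₀)).differential_comp hsℓ
    have h' : differential (QuotDual EG N) (StrongDual ℝ EG) (μ ∘ (s ∘ affineEmb N c)) β₀ =
        differential (QuotDual EG N) (StrongDual ℝ EG) (affineEmb N c) β₀ := hsecℓ.mfderiv_eq
    have h0 : (s ∘ affineEmb N c) β₀ = z := hs0
    rw [h', differential_affineEmb, h0] at h
    rw [h]
    rfl
  obtain ⟨ξ, hξ⟩ := exists_fundamentalField_eq (v := v - v₁) hfree hdim hμ hfib (hμs z)
    (by rw [map_sub, hv, hμv₁, sub_self])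
  obtain ⟨u₂, hu₂⟩ := exists_differential_val_eq (w := (1 : G)) (z := z) hZ
    (contMDiff_orbitMap EG E (G := G) (z : X) 1)
    (Eventually.of_forall fun g ↦ by
      have h := (hfib (z : X) (g • (z : X))).2 ⟨g, rfl⟩
      show iStar EG N (μ _) = iStar EG N c
      rw [← h]
      exact z.2)
    (by simp) ξ
  exact ⟨u₁ + u₂, by rw [map_add, hu₁, hu₂, hξ]; abel⟩

/-- The metric of the momentum level, as a field of inner products. -/
def levelForm (gt : SmoothMetric E X) (z : momentumLevel N μ c) : EZ →L[ℝ] EZ →L[ℝ] ℝ :=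
  pullForm (gt.form z) (differential EZ E (Subtype.val : momentumLevel N μ c → X) z)

theorem isInnerForm_levelForm (gt : SmoothMetric E X)
    (hZ : Manifold.IsSmoothEmbedding 𝓘(ℝ, EZ) 𝓘(ℝ, E) ∞ (Subtype.val : momentumLevel N μ c → X))
    (z : momentumLevel N μ c) : IsInnerForm (levelForm (EZ := EZ) gt z) :=
  (gt.isInnerForm z).pull fun _ hv ↦ (hZ.isImmersion.isImmersionAt z).mfderiv_injective
    (hv.trans (map_zero (differential EZ E (Subtype.val : momentumLevel N μ c → X) z)).symm)

/-- The push-forward of the metric of the momentum level along `q` is constant on `N`-orbits. -/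
theorem pushForm_levelForm_eq {gt : SmoothMetric E X} (hinv : IsInvariantMetric G gt)
    (hfib : FibresAreOrbits G μ)
    (hZ : Manifold.IsSmoothEmbedding 𝓘(ℝ, EZ) 𝓘(ℝ, E) ∞ (Subtype.val : momentumLevel N μ c → X))
    {EM : Type*} [NormedAddCommGroup EM] [NormedSpace ℝ EM] [FiniteDimensional ℝ EM]
    [ChartedSpace EM (ReducedSpace N μ c)]
    (hq : ContMDiff 𝓘(ℝ, EZ) 𝓘(ℝ, EM) ∞ (reducedProj N μ c))
    (hq' : ∀ z, Function.Surjective (differential EZ EM (reducedProj N μ c) z))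
    {z w : momentumLevel N μ c} (hzw : reducedProj N μ c z = reducedProj N μ c w) :
    pushForm (levelForm gt z) (differential EZ EM (reducedProj N μ c) z) =
      pushForm (levelForm gt w) (differential EZ EM (reducedProj N μ c) w) := by
  obtain ⟨n, hn, hnz⟩ : ∃ n ∈ N, n • (z : X) = w := Quotient.exact hzw
  -- the level is a union of fibres of `μ`, so that `G` acts on it by isometries
  have hmem : ∀ (a : G) (y : momentumLevel N μ c), a • (y : X) ∈ momentumLevel N μ c := by
    intro a y
    have h := (hfib (y : X) (a • (y : X))).2 ⟨a, rfl⟩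
    show iStar EG N (μ _) = iStar EG N c
    rw [← h]
    exact y.2
  let φ : G → momentumLevel N μ c → momentumLevel N μ c := fun a y ↦ ⟨a • (y : X), hmem a y⟩
  have hact : ∀ a : G, ContMDiff 𝓘(ℝ, E) 𝓘(ℝ, E) ∞ (fun x : X ↦ a • x) := fun a ↦
    ContMDiffSMul.contMDiff_const_smul (I := 𝓘(ℝ, EG)) a
  have hφ : ∀ a, ContMDiff 𝓘(ℝ, EZ) 𝓘(ℝ, EZ) ∞ (φ a) := fun a ↦
    ContMDiff.codRestrict_of_isSmoothEmbedding hZ ((hact a).comp hZ.contMDiff)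
  have hiso : ∀ (y : momentumLevel N μ c) (v w : EZ), levelForm gt (φ n y)
      (differential EZ EZ (φ n) y v) (differential EZ EZ (φ n) y w) = levelForm gt y v w := by
    intro y v w
    have h1 := (hZ.contMDiff (φ n y)).differential_comp (hφ n y)
    have h2 := (hact n (y : X)).differential_comp (hZ.contMDiff y)
    have h3 : ∀ u, differential EZ E Subtype.val (φ n y) (differential EZ EZ (φ n) y u) =
        differential E E (fun x : X ↦ n • x) y (differential EZ E Subtype.val y u) := fun u ↦
      (DFunLike.congr_fun h1 u).symm.trans (DFunLike.congr_fun h2 u)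
    simp only [levelForm, pullForm_apply]
    rw [h3, h3]
    exact hinv n y _ _
  have hsymm := pushForm_eq_of_symmetry (isInnerForm_levelForm gt hZ) hq hq' (hφ n) (hφ n⁻¹)
    (by ext y; simp [φ]) (by ext y; simp [φ])
    (by
      ext1 y
      exact (Quotient.sound (show (orbitSetoidOn N (momentumLevel N μ c)) y (φ n y) from
        ⟨n, hn, rfl⟩)).symm) hiso z
  have hw : φ n z = w := Subtype.ext hnz
  rw [← hsymm, hw]

/-- The map `ν` is smooth, since `ν ∘ q` is a component of the restriction of `μ - c̃`. -/
theorem contMDiff_reducedMomentum (hμ : ContMDiff 𝓘(ℝ, E) 𝓘(ℝ, StrongDual ℝ EG) ∞ μ)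
    (hfib : FibresAreOrbits G μ)
    (hZ : Manifold.IsSmoothEmbedding 𝓘(ℝ, EZ) 𝓘(ℝ, E) ∞ (Subtype.val : momentumLevel N μ c → X))
    {EM : Type*} [NormedAddCommGroup EM] [NormedSpace ℝ EM] [FiniteDimensional ℝ EM]
    [ChartedSpace EM (ReducedSpace N μ c)]
    (hq : ContMDiff 𝓘(ℝ, EZ) 𝓘(ℝ, EM) ∞ (reducedProj N μ c))
    (hq' : ∀ z, Function.Surjective (differential EZ EM (reducedProj N μ c) z)) :
    ContMDiff 𝓘(ℝ, EM) 𝓘(ℝ, QuotDual EG N) ∞ (reducedMomentum N μ c hfib) := by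
  refine contMDiff_of_comp_submersion hq hq' Quotient.mk_surjective ?_
  obtain ⟨r, hr⟩ :=
    (uStarL EG N : QuotDual EG N →ₗ[ℝ] StrongDual ℝ EG).exists_leftInverse_of_injective
      (LinearMap.ker_eq_bot'.2 (uStarL_injective N))
  have hr' : ∀ z, reducedMomentum N μ c hfib (reducedProj N μ c z) =
      r.toContinuousLinearMap (μ z - c) := by
    intro z
    have h : uStarL EG N (reducedMomentum N μ c hfib (reducedProj N μ c z)) = μ z - c :=
      eq_sub_of_add_eq (affineEmb_reducedMomentum N μ c hfib z)
    rw [← h]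
    exact (LinearMap.congr_fun hr _).symm
  have hsm : ContDiff ℝ ∞ (fun α : StrongDual ℝ EG ↦ r.toContinuousLinearMap (α - c)) :=
    ContDiff.comp (ContinuousLinearMap.contDiff (𝕜 := ℝ) (E := StrongDual ℝ EG)
      (F := QuotDual EG N) r.toContinuousLinearMap) (contDiff_id.sub contDiff_const)
  exact (hsm.contMDiff.comp (hμ.comp hZ.contMDiff)).congr hr'

end Reduction

end

theorem mainTheorem3
    -- the compact Lie group, the manifold, and the action
    {EG : Type*} [NormedAddCommGroup EG] [NormedSpace ℝ EG] [FiniteDimensional ℝ EG]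
    {G : Type*} [Group G] [TopologicalSpace G] [T2Space G] [CompactSpace G] [ChartedSpace EG G]
    [LieGroup 𝓘(ℝ, EG) ∞ G]
    {E : Type*} [NormedAddCommGroup E] [NormedSpace ℝ E] [FiniteDimensional ℝ E]
    {X : Type*} [TopologicalSpace X] [T2Space X] [SecondCountableTopology X] [ChartedSpace E X]
    [IsManifold 𝓘(ℝ, E) ∞ X]
    [MulAction G X] [ContMDiffSMul 𝓘(ℝ, EG) 𝓘(ℝ, E) ∞ G X]
    -- the symplectic form, the momentum map and the compatible invariant metric
    (Ω : ∀ x : X, TangentSpace 𝓘(ℝ, E) x →L[ℝ] TangentSpace 𝓘(ℝ, E) x →L[ℝ] ℝ)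
    (hsymp : IsSymplecticForm Ω)
    (μ : X → StrongDual ℝ EG) (hμ : IsMomentumMap G Ω μ)
    (gt : SmoothMetric E X) (hcompat : IsCompatibleMetric Ω gt) (hinv : IsInvariantMetric G gt)
    -- `G` acts freely, has half the dimension of the manifold, and `μ` is a principal bundle
    (hfree : ∀ (g : G) (z : X), g • z = z → g = 1)
    (hdim : 2 * Module.finrank ℝ EG = Module.finrank ℝ E)
    (hfib : FibresAreOrbits G μ)
    -- the closed normal subgroup and the momentum level
    (N : Subgroup G) [N.Normal] (hN : IsClosed (N : Set G))
    (c : StrongDual ℝ EG) (hc : ∀ g : G, c.comp (adjointAction EG g) = c)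
    -- the level set, with its structure of embedded submanifold
    {EZ : Type*} [NormedAddCommGroup EZ] [NormedSpace ℝ EZ] [FiniteDimensional ℝ EZ]
    [ChartedSpace EZ (momentumLevel N μ c)] [IsManifold 𝓘(ℝ, EZ) ∞ (momentumLevel N μ c)]
    (hZ : Manifold.IsSmoothEmbedding 𝓘(ℝ, EZ) 𝓘(ℝ, E) ∞
      (Subtype.val : momentumLevel N μ c → X))
    -- the quotient, with the smooth structure for which the projection is a submersion
    {EM : Type*} [NormedAddCommGroup EM] [NormedSpace ℝ EM] [FiniteDimensional ℝ EM]
    [ChartedSpace EM (ReducedSpace N μ c)] [IsManifold 𝓘(ℝ, EM) ∞ (ReducedSpace N μ c)]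
    (hq : ContMDiff 𝓘(ℝ, EZ) 𝓘(ℝ, EM) ∞ (reducedProj N μ c))
    (hq' : ∀ z, Function.Surjective (mfderiv 𝓘(ℝ, EZ) 𝓘(ℝ, EM) (reducedProj N μ c) z)) :
    -- existence and uniqueness of the reduced metric on the image of `μ`
    (∃ bt, IsReducedMetric (fun z v w ↦ gt.inner z v w) μ bt) ∧
    (∀ bt bt', IsReducedMetric (fun z v w ↦ gt.inner z v w) μ bt →
      IsReducedMetric (fun z v w ↦ gt.inner z v w) μ bt' → Set.EqOn bt bt' (Set.range μ)) ∧
    -- the metric `g` of the quotient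
    ∃ g : SmoothMetric EM (ReducedSpace N μ c),
      IsRiemannianSubmersion (gt.restrict (momentumLevel N μ c) EZ) (fun x v w ↦ g.inner x v w)
        (reducedProj N μ c) ∧
      (∀ g' : SmoothMetric EM (ReducedSpace N μ c),
        IsRiemannianSubmersion (gt.restrict (momentumLevel N μ c) EZ) (fun x v w ↦ g'.inner x v w)
          (reducedProj N μ c) → g' = g) ∧
      -- existence and uniqueness of the reduced metric on the image of `ν`
      (∃ b, IsReducedMetric (fun x v w ↦ g.inner x v w) (reducedMomentum N μ c hfib) b) ∧
      (∀ b b', IsReducedMetric (fun x v w ↦ g.inner x v w) (reducedMomentum N μ c hfib) b →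
        IsReducedMetric (fun x v w ↦ g.inner x v w) (reducedMomentum N μ c hfib) b' →
        Set.EqOn b b' (Set.range (reducedMomentum N μ c hfib))) ∧
      -- `ℓ` maps the image of `ν` to that of `μ`, and pulls back one reduced metric to the other
      Set.MapsTo (affineEmb N c) (Set.range (reducedMomentum N μ c hfib)) (Set.range μ) ∧
      ∀ bt b, IsReducedMetric (fun z v w ↦ gt.inner z v w) μ bt →
        IsReducedMetric (fun x v w ↦ g.inner x v w) (reducedMomentum N μ c hfib) b →
        ∀ β ∈ Set.range (reducedMomentum N μ c hfib), ∀ v w : QuotDual EG N,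
          bt (affineEmb N c β)
              (fderiv ℝ (affineEmb N c) β v) (fderiv ℝ (affineEmb N c) β w) = b β v w := by
  set gX := gt.form with hgX
  have hgi : ∀ x, IsInnerForm (gX x) := gt.isInnerForm
  have hμs := hμ.differential_surjective hsymp hfree
  -- `μ` is invariant, so that `G` acts by symmetries of `μ`
  obtain ⟨bt, hbt⟩ := exists_eq_pushForm (β := gX) (f := μ) (F := StrongDual ℝ EG) (by
    intro x x' hxx'
    obtain ⟨a, rfl⟩ := (hfib x x').1 hxx'
    have hact : ∀ a : G, ContMDiff 𝓘(ℝ, E) 𝓘(ℝ, E) ∞ (fun x : X ↦ a • x) := fun a ↦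
      ContMDiffSMul.contMDiff_const_smul (I := 𝓘(ℝ, EG)) a
    exact (pushForm_eq_of_symmetry hgi hμ.smooth hμs (hact a) (hact a⁻¹)
      (by ext; simp) (by ext; simp) (funext fun y ↦ ((hfib y (a • y)).2 ⟨a, rfl⟩).symm)
      (hinv a) x).symm)
  have hredμ : ∀ bt, IsReducedMetric (fun z v w ↦ gt.inner z v w) μ bt ↔ _ := fun bt ↦
    isReducedMetric_iff (b := bt) (f := μ) hgi gt.isSmoothFormAt
  -- the metric of the quotient
  have hqs : Function.Surjective (reducedProj N μ c) := Quotient.mk_surjective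
  have hq'' : ∀ z, Function.Surjective (differential EZ EM (reducedProj N μ c) z) := hq'
  have hZi := isInnerForm_levelForm gt hZ
  obtain ⟨bM, hbM⟩ := exists_eq_pushForm (β := levelForm gt) (f := reducedProj N μ c) (F := EM)
    fun z w ↦ pushForm_levelForm_eq hinv hfib hZ hq hq''
  have hbMi : ∀ m, IsInnerForm (bM m) := fun m ↦ by
    obtain ⟨z, rfl⟩ := hqs m
    rw [hbM]
    exact (hZi z).push (hq'' z)
  have hbMs : ∀ m, IsSmoothFormAt bM m := fun m ↦ by
    obtain ⟨z, rfl⟩ := hqs m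
    exact ((gt.isSmoothFormAt z).pullback (hZ.contMDiff z)).pushForward hZi (hq z) hq'' hbM
  have hsubq : ∀ g : SmoothMetric EM (ReducedSpace N μ c),
      IsRiemannianSubmersion (gt.restrict (momentumLevel N μ c) EZ) (fun x v w ↦ g.inner x v w)
        (reducedProj N μ c) ↔ _ := fun g ↦
    isRiemannianSubmersion_iff (b := g.form) (f := reducedProj N μ c) hZi
  -- the differential of `ν`, and its relation to that of `μ`
  set ν := reducedMomentum N μ c hfib with hν
  have hνsm : ContMDiff 𝓘(ℝ, EM) 𝓘(ℝ, QuotDual EG N) ∞ ν :=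
    contMDiff_reducedMomentum hμ.smooth hfib hZ hq hq''
  have hℓν : ∀ z, affineEmb N c (ν (reducedProj N μ c z)) = μ z :=
    affineEmb_reducedMomentum N μ c hfib
  set ι : momentumLevel N μ c → X := Subtype.val with hι
  have hDνq : ∀ z u, uStarL EG N (differential EM (QuotDual EG N) ν (reducedProj N μ c z)
      (differential EZ EM (reducedProj N μ c) z u)) =
        differential E (StrongDual ℝ EG) μ z (differential EZ E ι z u) := by
    intro z u
    have h1 := (hνsm (reducedProj N μ c z)).differential_comp (hq z)
    have h2 := ContMDiffAt.differential_comp (x := z) (f := ν ∘ reducedProj N μ c)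
      ((contDiff_affineEmb N c).contMDiff _) ((hνsm.comp hq) z)
    have h3 := (hμ.smooth z).differential_comp (hZ.contMDiff z)
    have h4 : affineEmb N c ∘ (ν ∘ reducedProj N μ c) = μ ∘ ι := funext hℓν
    rw [h4, h3, differential_affineEmb, h1] at h2
    exact (DFunLike.congr_fun h2 u).symm
  have htan : ∀ (z : momentumLevel N μ c) {v : E} {β : QuotDual EG N},
      differential E (StrongDual ℝ EG) μ z v = uStarL EG N β →
        ∃ u : EZ, differential EZ E ι z u = v := fun z _ _ ↦
    exists_differential_val_eq_of_differential_eq_uStarL hfree hdim hμ.smooth hfib hμs hZ z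
  have hνq' : ∀ z, Function.Surjective (differential EM (QuotDual EG N) ν (reducedProj N μ c z) ∘L
      differential EZ EM (reducedProj N μ c) z) := by
    intro z β
    obtain ⟨v, hv⟩ := hμs z (uStarL EG N β)
    obtain ⟨u, hu⟩ := htan z hv
    refine ⟨u, sub_eq_zero.1 (uStarL_injective N _ ?_)⟩
    rw [map_sub, ContinuousLinearMap.comp_apply, hDνq, hu, hv, sub_self]
  have hνs : ∀ m, Function.Surjective (differential EM (QuotDual EG N) ν m) := by
    intro m β
    obtain ⟨z, rfl⟩ := hqs m
    obtain ⟨u, hu⟩ := hνq' z β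
    exact ⟨_, hu⟩
  -- the push-forwards along `ν` are the pullbacks under `u*` of the push-forwards along `μ`
  have hkey : ∀ z : momentumLevel N μ c,
      pullForm (pushForm (gX z) (differential E (StrongDual ℝ EG) μ z)) (uStarL EG N) =
      pushForm (bM (reducedProj N μ c z))
        (differential EM (QuotDual EG N) ν (reducedProj N μ c z)) := by
    intro z
    rw [hbM, (hZi z).pushForm_comp (hq'' z) (hνs _)]
    exact (hZi z).pushForm_natural (hνq' z) (hgi z) (hμs z) (differential EZ E ι z) (uStarL EG N)
      (fun k hk ↦ htan z (β := 0) (by rw [hk, map_zero])) (uStarL_injective N)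
      (fun _ _ ↦ rfl) (fun u ↦ (hDνq z u).symm)
  have hredν : ∀ b, IsReducedMetric (fun x v w ↦
      (SmoothMetric.ofForm bM hbMi hbMs).inner x v w) ν b ↔ _ := fun b ↦
    isReducedMetric_iff (b := b) (f := ν) hbMi hbMs
  refine ⟨⟨bt, (hredμ bt).2 ⟨hμ.smooth, hμs, hbt⟩⟩, ?_, SmoothMetric.ofForm bM hbMi hbMs,
    (hsubq _).2 ⟨hq, hq'', hbM⟩, ?_, ⟨fun β ↦ pullForm (bt (affineEmb N c β)) (uStarL EG N),
    (hredν _).2 ⟨hνsm, hνs, ?_⟩⟩, ?_, ?_, ?_⟩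
  · rintro b b' hb hb' _ ⟨x, rfl⟩
    rw [((hredμ b).1 hb).2.2, ((hredμ b').1 hb').2.2]
  · intro g' hg'
    refine SmoothMetric.form_injective (funext fun m ↦ ?_)
    obtain ⟨z, rfl⟩ := hqs m
    exact (((hsubq g').1 hg').2.2 z).trans (hbM z).symm
  · intro m
    obtain ⟨z, rfl⟩ := hqs m
    rw [hℓν, hbt, hkey]
  · rintro b b' hb hb' _ ⟨m, rfl⟩
    rw [((hredν b).1 hb).2.2, ((hredν b').1 hb').2.2]
  · rintro _ ⟨m, rfl⟩
    obtain ⟨z, rfl⟩ := hqs m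
    exact ⟨z, (hℓν z).symm⟩
  · rintro bt b hbt hb _ ⟨m, rfl⟩ v w
    obtain ⟨z, rfl⟩ := hqs m
    rw [(hasFDerivAt_affineEmb N c _).fderiv, ((hredν b).1 hb).2.2, ← hkey, hℓν,
      ((hredμ bt).1 hbt).2.2]
    rfl
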